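/- A ZX-diagram with $m$ inputs and $n$ outputs is an open multigraph of $Z$-spiders $|0\cdots0\rangle\langle0\cdots0|+e^{i\alpha}|1\cdots1\rangle\langle1\cdots1|$ and $X$-spiders $|{+}\cdots{+}\rangle\langle{+}\cdots{+}|+e^{i\alpha}|{-}\cdots{-}\rangle\langle{-}\cdots{-}|$ joined by plain wires or Hadamard edges; contracting it gives a linear map $[\![D]\!]:(\mathbb C^2)^{\otimes m}\to(\mathbb C^2)^{\otimes n}$, and diagrams are considered equal when their linear maps agree up to a non-zero scalar. $D$ is *graph-like* when all spiders are $Z$-spiders, spiders are joined only by Hadamard edges, there are no parallel edges and no self-loops, every input or output is attached by a plain wire to a spider, and every spider is attached to at most one input or output. A spider is *boundary* if it is attached to an input or output, and *interior* otherwise. It is *Pauli*, *Clifford*, *proper Clifford* if its phase is a multiple of $\pi$, a multiple of $\pi/2$, an odd multiple of $\pi/2$, respectively. Consider the following rewrite rules on graph-like diagrams, where $G$ is the graph of spiders and Hadamard edges, $G\star u$ is local complementation and $G\wedge uv=G\star u\star v\star u$ is the pivot: (LC) if $u$ is an interior proper Clifford spider, replace $G$ by $(G\star u)\setminus u$ and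 subtract the phase of $u$ from the phase of each neighbour of $u$; (P) if $u,v$ are adjacent interior Pauli spiders with phases $j\pi,k\pi$, replace $G$ by $(G\wedge uv)\setminus\{u,v\}$ and add $k\pi$ to the phases of the neighbours of $u$ alone, $j\pi$ to those of the neighbours of $v$ alone, and $(j+k+1)\pi$ to those of the common neighbours; (B) if $u$ is an interior Pauli spider adjacent to a boundary spider $v$ of phase $\alpha$ attached to an input or output $b$, make $v$ a phaseless interior spider, join it by a Hadamard edge to a new phaseless spider attached to $b$, split off a Hadamard gate and the phase gate $Z_\alpha$ (with $Z_\alpha$ next to $b$'s end) as a single-qubit unitary at $b$, and immediately apply (P) to $u,v$; (S) delete an isolated interior spider of phase $0$ (the non-zero scalar $2$). **Theorem.** Let $D$ be a graph-like ZX-diagram. Applying these rules to $D$ in any order terminates. All diagrams produced are graph-like, and are equal to $D$ up to the split-off single-qubit unitaries on the inputs and outputs: if $D'$ is produced, with split-off unitaries $U_i$ on the inputs and $W_j$ on the outputs, then $[\![D]\!]=z\,(\bigotimes_jW_j)\,[\![D']\!]\,(\bigotimes_iU_i)$ for some $z\neq0$. If no rule applies to $D'$ any more, then $D'$ contains 1.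 no interior proper Clifford spiders, 2. no adjacent pairs of interior Pauli spiders, 3. no interior Pauli spider adjacent to a boundary spider. In particular, suppose that $D$ contains only Clifford spiders. Then $D'$ contains only Clifford spiders, the split-off unitaries are compositions of $H$ and $S=Z_{\pi/2}$, and every interior spider of $D'$ is isolated and has phase $\pi$ (the scalar $0$); hence, if $[\![D]\!]\neq0$, then $D'$ contains no interior spiders (GS-LC form). -/

import Mathlib

open scoped Matrix

/-! ### Angles and elementary single-qubit matrices -/

namespace ZX

/-- The angle is a multiple of `π`. -/
def IsPauliAngle (α : Real.Angle) : Prop :=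
  ∃ k : ℤ, α = ((k * Real.pi : ℝ) : Real.Angle)

/-- The angle is a multiple of `π / 2`. -/
def IsCliffordAngle (α : Real.Angle) : Prop :=
  ∃ k : ℤ, α = ((k * (Real.pi / 2) : ℝ) : Real.Angle)

/-- The angle is an odd multiple of `π / 2`. -/
def IsProperCliffordAngle (α : Real.Angle) : Prop :=
  ∃ k : ℤ, α = (((2 * k + 1) * (Real.pi / 2) : ℝ) : Real.Angle)

/-- The Hadamard matrix. -/
noncomputable def hadamard : Matrix (Fin 2) (Fin 2) ℂ :=
  ((Real.sqrt 2 : ℝ) : ℂ)⁻¹ • !![1, 1; 1, -1]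

/-- The phase gate `Z_α = |0⟩⟨0| + e^{iα} |1⟩⟨1|`. -/
noncomputable def phaseGate (α : Real.Angle) : Matrix (Fin 2) (Fin 2) ℂ :=
  !![1, 0; 0, (α.toCircle : ℂ)]

/-- A single-qubit gate is local Clifford when it is a composition of `H` and `S = Z_{π/2}`. -/
def IsLocalClifford (U : Matrix (Fin 2) (Fin 2) ℂ) : Prop :=
  U ∈ Submonoid.closure
    ({hadamard, phaseGate ((Real.pi / 2 : ℝ) : Real.Angle)} : Set (Matrix (Fin 2) (Fin 2) ℂ))

/-- The tensor product `U 0 ⊗ U 1 ⊗ ⋯` of single-qubit operators, in the computational basis. -/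
def tensorGates {k : ℕ} (U : Fin k → Matrix (Fin 2) (Fin 2) ℂ) :
    Matrix (Fin k → Fin 2) (Fin k → Fin 2) ℂ :=
  Matrix.of fun y x => ∏ i, U i (y i) (x i)

theorem hadamard_isSymm : hadamard.IsSymm := by
  ext i j
  fin_cases i <;> fin_cases j <;> simp [hadamard]

/-! ### ZX-diagrams -/

/-- `Z` spiders (green) and `X` spiders (red). -/
inductive Colour
  | Z
  | X

/-- The basis copied by a spider of the given colour: `|0⟩, |1⟩` for `Z`, and
`|+⟩, |-⟩` for `X`. -/
noncomputable def Colour.ket : Colour → Fin 2 → Fin 2 → ℂ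
  | .Z, b => fun s => if s = b then 1 else 0
  | .X, b => fun s => hadamard s b

/-- A ZX-diagram with `m` inputs and `n` outputs, considered up to deformation: an undirected
multigraph whose nodes are the spiders, the inputs and the outputs. A node `Sum.inl v` is a spider,
`Sum.inr (Sum.inl i)` is an input and `Sum.inr (Sum.inr j)` an output. `plain s(a, c)` is the number
of plain wires and `had s(a, c)` the number of Hadamard edges joining `a` and `c` (parallel wires and
self-loops are allowed). Exactly one wire ends at each input and at each output. -/
structure ZXDiagram (m n : ℕ) where
  Spider : Type
  [fintypeSpider : Fintype Spider]
  [decEqSpider : DecidableEq Spider]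
  colour : Spider → Colour
  phase : Spider → Real.Angle
  plain : Sym2 (Spider ⊕ (Fin m ⊕ Fin n)) → ℕ
  had : Sym2 (Spider ⊕ (Fin m ⊕ Fin n)) → ℕ
  boundary_degree : ∀ b : Fin m ⊕ Fin n,
    (∑ c, (plain s(Sum.inr b, c) + had s(Sum.inr b, c)))
      + (plain s(Sum.inr b, Sum.inr b) + had s(Sum.inr b, Sum.inr b)) = 1

attribute [instance] ZXDiagram.fintypeSpider ZXDiagram.decEqSpider

/-- The number `⟨f a| M |f c⟩` attached to a wire `s(a, c)` carrying the symmetric matrix `M`, where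
the leg at a node `a` is in the real state `f a`. -/
def wireValue {N : Type} (M : Matrix (Fin 2) (Fin 2) ℂ) (hM : M.IsSymm) (f : N → Fin 2 → ℂ) :
    Sym2 N → ℂ :=
  Sym2.lift ⟨fun a c => f a ⬝ᵥ (M *ᵥ f c), fun a c => by
    change f a ⬝ᵥ (M *ᵥ f c) = f c ⬝ᵥ (M *ᵥ f a)
    rw [Matrix.dotProduct_mulVec, ← Matrix.mulVec_transpose, hM.eq, dotProduct_comm]⟩

namespace ZXDiagram

variable {m n : ℕ}

/-- The spiders, inputs and outputs of a diagram. -/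
abbrev Node (D : ZXDiagram m n) : Type := D.Spider ⊕ (Fin m ⊕ Fin n)

/-- The state of the legs at each node, when spider `v` is in its `σ v`-th branch, the inputs carry
`x` and the outputs `y` in the computational basis. -/
noncomputable def legState (D : ZXDiagram m n) (σ : D.Spider → Fin 2) (x : Fin m → Fin 2)
    (y : Fin n → Fin 2) : D.Node → Fin 2 → ℂ
  | .inl v => (D.colour v).ket (σ v)
  | .inr (.inl i) => Colour.Z.ket (x i)
  | .inr (.inr j) => Colour.Z.ket (y j)

/-- The linear map `(ℂ²)^{⊗ m} → (ℂ²)^{⊗ n}` of a diagram, as a matrix in the computational basis.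
It is the contraction along the wires of the spider tensors
`|0…0⟩⟨0…0| + e^{iα} |1…1⟩⟨1…1|` and `|+…+⟩⟨+…+| + e^{iα} |-…-⟩⟨-…-|`; the sum over `σ` expands
each spider into its two branches. -/
noncomputable def interp (D : ZXDiagram m n) : Matrix (Fin n → Fin 2) (Fin m → Fin 2) ℂ :=
  Matrix.of fun y x => ∑ σ : D.Spider → Fin 2,
    (∏ v, if σ v = 1 then ((D.phase v).toCircle : ℂ) else 1) *
      ∏ p : Sym2 D.Node,
        wireValue 1 Matrix.isSymm_one (D.legState σ x y) p ^ D.plain p *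
        wireValue hadamard hadamard_isSymm (D.legState σ x y) p ^ D.had p

/-- Two nodes are joined by a wire (plain or Hadamard). -/
def Connected (D : ZXDiagram m n) (a c : D.Node) : Prop :=
  D.plain s(a, c) ≠ 0 ∨ D.had s(a, c) ≠ 0

/-- A spider is a boundary spider when it is connected to an input or an output. -/
def IsBoundary (D : ZXDiagram m n) (v : D.Spider) : Prop :=
  ∃ b : Fin m ⊕ Fin n, D.Connected (Sum.inl v) (Sum.inr b)

/-- A spider is interior when it is not connected to an input or an output. -/
def IsInterior (D : ZXDiagram m n) (v : D.Spider) : Prop := ¬ D.IsBoundary v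

/-- Graph-like ZX-diagrams. -/
structure IsGraphLike (D : ZXDiagram m n) : Prop where
  /-- All spiders are `Z` spiders. -/
  all_Z : ∀ v, D.colour v = Colour.Z
  /-- Spiders are connected only via Hadamard edges. -/
  no_plain : ∀ v w, D.plain s(Sum.inl v, Sum.inl w) = 0
  /-- There are no parallel Hadamard edges. -/
  no_parallel : ∀ v w, D.had s(Sum.inl v, Sum.inl w) ≤ 1
  /-- There are no self-loops. -/
  no_loop : ∀ v, D.had s(Sum.inl v, Sum.inl v) = 0
  /-- Every input and output is connected (by a plain wire) to a spider. -/
  boundary_spider : ∀ b, ∃ v, D.plain s(Sum.inl v, Sum.inr b) ≠ 0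
  /-- Every spider is connected to at most one input or output. -/
  at_most_one : ∀ v b b', D.Connected (Sum.inl v) (Sum.inr b) →
    D.Connected (Sum.inl v) (Sum.inr b') → b = b'

end ZXDiagram

/-! ### Local complementation and pivoting -/

/-- Local complementation `G ⋆ u`. -/
def localComplement {V : Type} (G : SimpleGraph V) (u : V) : SimpleGraph V where
  Adj v w := v ≠ w ∧ Xor (G.Adj v w) (G.Adj u v ∧ G.Adj u w)
  symm := ⟨fun v w h => by
    refine ⟨h.1.symm, ?_⟩
    have h2 := h.2
    rwa [G.adj_comm, and_comm] at h2⟩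
  loopless := ⟨fun _ h => h.1 rfl⟩

/-- The pivot `G ∧ uv = G ⋆ u ⋆ v ⋆ u`. -/
def pivot {V : Type} (G : SimpleGraph V) (u v : V) : SimpleGraph V :=
  localComplement (localComplement (localComplement G u) v) u

/-- An open graph with an angle at each vertex. `terminal` tells which vertex each input and output
is attached to; no vertex carries two of them. -/
structure AngledOpenGraph (m n : ℕ) where
  V : Type
  [fintypeV : Fintype V]
  [decEqV : DecidableEq V]
  graph : SimpleGraph V
  phase : V → Real.Angle
  terminal : (Fin m ⊕ Fin n) ↪ V

attribute [instance] AngledOpenGraph.fintypeV AngledOpenGraph.decEqV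

namespace AngledOpenGraph

variable {m n : ℕ}

open Classical in
/-- The graph-like diagram of an open graph with angles: its spiders are `Z` spiders on the vertices,
its Hadamard edges are the edges of the graph, and the plain wires attach the inputs and outputs. -/
noncomputable def toZX (A : AngledOpenGraph m n) : ZXDiagram m n where
  Spider := A.V
  colour _ := Colour.Z
  phase := A.phase
  plain p := if ∃ b, p = s(Sum.inl (A.terminal b), Sum.inr b) then 1 else 0
  had p := if ∃ v w, A.graph.Adj v w ∧ p = s(Sum.inl v, Sum.inl w) then 1 else 0
  boundary_degree b := by
    simp

/-- A vertex without input or output. -/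
def IsInterior (A : AngledOpenGraph m n) (v : A.V) : Prop := ∀ b, A.terminal b ≠ v

/-- Delete the vertices outside `S` (which must retain all inputs and outputs), after replacing the
graph and the angles. -/
def restrict (A : AngledOpenGraph m n) (G : SimpleGraph A.V) (α : A.V → Real.Angle)
    (S : A.V → Prop) [DecidablePred S] (hS : ∀ b, S (A.terminal b)) : AngledOpenGraph m n where
  V := {x // S x}
  graph := G.comap Subtype.val
  phase x := α x.1
  terminal := ⟨fun b => ⟨A.terminal b, hS b⟩, fun _ _ h => A.terminal.injective (congrArg Subtype.val h)⟩

/-- Delete an interior vertex. -/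
def deleteVertex (A : AngledOpenGraph m n) (u : A.V) (hu : A.IsInterior u) : AngledOpenGraph m n :=
  A.restrict A.graph A.phase (fun x => x ≠ u) hu

open Classical in
/-- The right-hand side of the local complementation rule at `u`: complement locally at `u`, delete
`u`, and subtract the phase `± π/2` of `u` from the phases of its neighbours. -/
noncomputable def lcSimp (A : AngledOpenGraph m n) (u : A.V) (hu : A.IsInterior u) :
    AngledOpenGraph m n :=
  A.restrict (localComplement A.graph u)
    (fun x => A.phase x - if A.graph.Adj u x then A.phase u else 0)
    (fun x => x ≠ u) hu

open Classical in
/-- The right-hand side of the pivot rule along the edge `uv`, where `u` and `v` have phases `jπ` and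
`kπ`: pivot along `uv`, delete `u` and `v`, and add `kπ` to the phases of the exclusive neighbours of
`u`, `jπ` to those of the exclusive neighbours of `v`, and `(j + k + 1)π` to those of the common
neighbours. -/
noncomputable def pivotSimp (A : AngledOpenGraph m n) (u v : A.V) (hu : A.IsInterior u)
    (hv : A.IsInterior v) : AngledOpenGraph m n :=
  A.restrict (pivot A.graph u v)
    (fun x => A.phase x + (if A.graph.Adj u x then A.phase v else 0)
      + (if A.graph.Adj v x then A.phase u else 0)
      + (if A.graph.Adj u x ∧ A.graph.Adj v x then (Real.pi : Real.Angle) else 0))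
    (fun x => x ≠ u ∧ x ≠ v) (fun b => ⟨hu b, hv b⟩)

/-- Unfusing the boundary spider `v` at the input or output `b`: `v` becomes a phaseless interior
spider, joined by a Hadamard edge to a new phaseless spider (`none`), to which `b` is now
attached. The gate between the new spider and `b` (a Hadamard and the old phase of `v`) is not part
of the resulting diagram. -/
noncomputable def unfuse (A : AngledOpenGraph m n) (b : Fin m ⊕ Fin n) : AngledOpenGraph m n where
  V := Option A.V
  graph :=
    { Adj := fun x y => match x, y with
        | some v, some w => A.graph.Adj v w
        | none, some v => v = A.terminal b
        | some v, none => v = A.terminal b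
        | none, none => False
      symm := ⟨fun x y h => by
        cases x <;> cases y <;> simp_all [SimpleGraph.adj_comm]⟩
      loopless := ⟨fun x h => by cases x <;> simp_all⟩ }
  phase x := match x with
    | none => 0
    | some v => if v = A.terminal b then 0 else A.phase v
  terminal :=
    ⟨fun b' => if b' = b then none else some (A.terminal b'), fun b₁ b₂ h => by
      by_cases h₁ : b₁ = b <;> by_cases h₂ : b₂ = b <;> simp_all⟩

theorem unfuse_interior_boundary (A : AngledOpenGraph m n) (b : Fin m ⊕ Fin n) :
    (A.unfuse b).IsInterior (some (A.terminal b)) := by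
  intro b' h
  by_cases hb : b' = b
  · have h' : (none : Option A.V) = _ := (if_pos hb).symm.trans h
    cases h'
  · have h' : some (A.terminal b') = some (A.terminal b) := (if_neg hb).symm.trans h
    exact hb (A.terminal.injective (Option.some.inj h'))

theorem unfuse_interior (A : AngledOpenGraph m n) (b : Fin m ⊕ Fin n) (u : A.V)
    (hu : A.IsInterior u) : (A.unfuse b).IsInterior (some u) := by
  intro b' h
  by_cases hb : b' = b
  · have h' : (none : Option A.V) = _ := (if_pos hb).symm.trans h
    cases h'
  · have h' : some (A.terminal b') = some u := (if_neg hb).symm.trans h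
    exact hu b' (Option.some.inj h')

/-- Unfuse the boundary spider `v` at `b`, then pivot along the edge between `v` and the interior
vertex `u`. -/
noncomputable def boundaryPivotSimp (A : AngledOpenGraph m n) (b : Fin m ⊕ Fin n) (u : A.V)
    (hu : A.IsInterior u) : AngledOpenGraph m n :=
  (A.unfuse b).pivotSimp (some u) (some (A.terminal b)) (A.unfuse_interior b u hu)
    (A.unfuse_interior_boundary b)

end AngledOpenGraph

/-! ### The simplification procedure -/

/-- A configuration of the procedure: a diagram, with the single-qubit gates that have been split off
at its inputs and outputs. -/
structure Config (m n : ℕ) where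
  diagram : ZXDiagram m n
  inGate : Fin m → Matrix (Fin 2) (Fin 2) ℂ
  outGate : Fin n → Matrix (Fin 2) (Fin 2) ℂ

/-- The initial configuration: the given diagram and identity gates. -/
def Config.init {m n : ℕ} (D : ZXDiagram m n) : Config m n where
  diagram := D
  inGate _ := 1
  outGate _ := 1

/-- The linear map of a configuration: input gates, then the diagram, then output gates. -/
noncomputable def Config.interp {m n : ℕ} (C : Config m n) :
    Matrix (Fin n → Fin 2) (Fin m → Fin 2) ℂ :=
  tensorGates C.outGate * C.diagram.interp * tensorGates C.inGate

/-- One rewrite step of the procedure, written on the open graph with angles of the graph-like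
diagram. -/
inductive Step {m n : ℕ} : Config m n → Config m n → Prop
  /-- Remove an interior proper Clifford spider by local complementation. -/
  | lc (A : AngledOpenGraph m n) (P : Fin m → Matrix (Fin 2) (Fin 2) ℂ)
      (Q : Fin n → Matrix (Fin 2) (Fin 2) ℂ) (u : A.V) (hu : A.IsInterior u)
      (hphase : IsProperCliffordAngle (A.phase u)) :
      Step ⟨A.toZX, P, Q⟩ ⟨(A.lcSimp u hu).toZX, P, Q⟩
  /-- Remove an adjacent pair of interior Pauli spiders by pivoting. -/
  | pivot (A : AngledOpenGraph m n) (P : Fin m → Matrix (Fin 2) (Fin 2) ℂ)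
      (Q : Fin n → Matrix (Fin 2) (Fin 2) ℂ) (u v : A.V) (hu : A.IsInterior u)
      (hv : A.IsInterior v) (huv : A.graph.Adj u v)
      (hpu : IsPauliAngle (A.phase u)) (hpv : IsPauliAngle (A.phase v)) :
      Step ⟨A.toZX, P, Q⟩ ⟨(A.pivotSimp u v hu hv).toZX, P, Q⟩
  /-- Remove an interior Pauli spider adjacent to the boundary spider at input `i`. -/
  | inputPivot (A : AngledOpenGraph m n) (P : Fin m → Matrix (Fin 2) (Fin 2) ℂ)
      (Q : Fin n → Matrix (Fin 2) (Fin 2) ℂ) (u : A.V) (hu : A.IsInterior u)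
      (hpu : IsPauliAngle (A.phase u)) (i : Fin m)
      (hadj : A.graph.Adj u (A.terminal (Sum.inl i))) :
      Step ⟨A.toZX, P, Q⟩
        ⟨(A.boundaryPivotSimp (Sum.inl i) u hu).toZX,
          Function.update P i (hadamard * phaseGate (A.phase (A.terminal (Sum.inl i))) * P i), Q⟩
  /-- Remove an interior Pauli spider adjacent to the boundary spider at output `j`. -/
  | outputPivot (A : AngledOpenGraph m n) (P : Fin m → Matrix (Fin 2) (Fin 2) ℂ)
      (Q : Fin n → Matrix (Fin 2) (Fin 2) ℂ) (u : A.V) (hu : A.IsInterior u)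
      (hpu : IsPauliAngle (A.phase u)) (j : Fin n)
      (hadj : A.graph.Adj u (A.terminal (Sum.inr j))) :
      Step ⟨A.toZX, P, Q⟩
        ⟨(A.boundaryPivotSimp (Sum.inr j) u hu).toZX, P,
          Function.update Q j (Q j * (phaseGate (A.phase (A.terminal (Sum.inr j))) * hadamard))⟩
  /-- Drop an isolated phaseless interior spider, which is the non-zero scalar `2`. -/
  | scalar (A : AngledOpenGraph m n) (P : Fin m → Matrix (Fin 2) (Fin 2) ℂ)
      (Q : Fin n → Matrix (Fin 2) (Fin 2) ℂ) (u : A.V) (hu : A.IsInterior u)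
      (hisol : ∀ v, ¬ A.graph.Adj u v) (hphase : A.phase u = 0) :
      Step ⟨A.toZX, P, Q⟩ ⟨(A.deleteVertex u hu).toZX, P, Q⟩

/-- The procedure can move from one configuration to the other in finitely many steps. -/
def Reaches {m n : ℕ} : Config m n → Config m n → Prop := Relation.ReflTransGen Step

/-- No rewrite rule matches. -/
def IsFinal {m n : ℕ} (C : Config m n) : Prop := ∀ C', ¬ Step C C'

end ZX

namespace ZX

/-! ### Signs of graphs -/

section EdgeSign

variable {V : Type} [Fintype V] [DecidableEq V]

/-! Everything is computed as a sum over spider states. For a graph-like diagram the contraction is,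
up to one factor `1/√2` per Hadamard edge, the sum `amp` over bit assignments `σ` of the phases of
the spiders in state `1` times `(-1)` to the number of edges inside `σ⁻¹(1)`, with each boundary
spider pinned to the bit of its input or output (`interp_toZX`). This sign is multiplicative under
symmetric difference of edge sets (`edgeSign_xor`), and a clique with `k` vertices in state `1`
contributes `(-1)^(k choose 2)`.

Each rule sums out the states of the deleted spiders. A spider with `a` neighbours in state `1` and
phase factor `e` contributes `1 + e(-1)^a`. If `e² = -1`, this is `(1 + e) e^(-a) (-1)^(a choose 2)`
(`lc_identity`): a non-zero scalar, a phase on each neighbour, and a complemented neighbourhood. An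
adjacent Pauli pair contributes four terms, which factor in the same way (`pivot_identity`). An
isolated spider contributes `1 + e`, which is `2` at phase `0` and `0` at phase `π`. The boundary
rule inserts `H H = 1` next to the terminal (`amp_unfuse`) and then pivots.

Every rule lowers the number of spiders, hence termination. Every graph-like diagram is the `toZX`
of an open graph (`exists_eq_toZX`), so a forbidden configuration is always a match for some rule.
In the Clifford case all phases stay Clifford; a remaining interior spider is then Pauli, can have
neither an interior nor a boundary neighbour, and has phase `π` because phase `0` would be deleted.
Such a spider makes the whole map vanish. -/

open Classical in
/-- The product of a factor `-1` for each edge both of whose ends are in state `1`. -/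
noncomputable def edgeSign (G : SimpleGraph V) (σ : V → Fin 2) : ℂ :=
  ∏ e : Sym2 V, if e ∈ G.edgeSet ∧ ∀ v ∈ e, σ v = 1 then -1 else 1

open Classical in
/-- The number of vertices in state `1` that satisfy `p`. -/
noncomputable def onesCard (p : V → Prop) (σ : V → Fin 2) : ℕ :=
  (Finset.univ.filter fun x => p x ∧ σ x = 1).card

omit [DecidableEq V] in
open Classical in
theorem prod_ite_eq_pow_onesCard (p : V → Prop) (σ : V → Fin 2) (c : ℂ) :
    ∏ x, (if p x ∧ σ x = 1 then c else 1) = c ^ onesCard p σ := by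
  rw [Finset.prod_ite, Finset.prod_const, Finset.prod_const_one, mul_one, onesCard]

omit [DecidableEq V] in
theorem onesCard_subtype (S p : V → Prop) [DecidablePred S] (σ : V → Fin 2) :
    onesCard (fun x : {x // S x} => p x.1) (fun x => σ x.1) = onesCard (fun x => S x ∧ p x) σ := by
  classical
  unfold onesCard
  rw [← Finset.card_map (Function.Embedding.subtype S)]
  congr 1
  ext x
  simp only [Finset.mem_map, Finset.mem_filter, Finset.mem_univ, true_and,
    Function.Embedding.subtype_apply, Subtype.exists]
  constructor
  · rintro ⟨a, ha, h, rfl⟩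
    exact ⟨⟨ha, h.1⟩, h.2⟩
  · rintro ⟨⟨ha, h⟩, h'⟩
    exact ⟨x, ha, ⟨h, h'⟩, rfl⟩

open Classical in
theorem edgeSign_eq_prod_finset (G : SimpleGraph V) (σ : V → Fin 2) (F : Finset (Sym2 V))
    (hF : ∀ e, e ∈ F ↔ e ∈ G.edgeSet) :
    edgeSign G σ = ∏ e ∈ F, if ∀ v ∈ e, σ v = 1 then -1 else 1 := by
  have h : F = Finset.univ.filter fun e => e ∈ G.edgeSet := by
    ext e
    simp [hF]
  rw [h, Finset.prod_filter, edgeSign]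
  refine Finset.prod_congr rfl fun e _ => ?_
  by_cases h₁ : e ∈ G.edgeSet <;> simp [h₁]

/-- The sign is `-1` to the number of edges inside the support of `σ`, and modulo `2` this number is
additive under symmetric difference. All later decompositions of graphs rest on this. -/
theorem edgeSign_xor (G H K : SimpleGraph V)
    (h : ∀ v w, v ≠ w → (K.Adj v w ↔ Xor (G.Adj v w) (H.Adj v w))) (σ : V → Fin 2) :
    edgeSign K σ = edgeSign G σ * edgeSign H σ := by
  unfold edgeSign
  rw [← Finset.prod_mul_distrib]
  refine Finset.prod_congr rfl fun e _ => ?_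
  induction e using Sym2.ind with
  | _ v w =>
    by_cases hvw : v = w
    · subst hvw
      simp
    · have hK := h v w hvw
      rw [xor_def] at hK
      rw [← SimpleGraph.mem_edgeSet, ← SimpleGraph.mem_edgeSet, ← SimpleGraph.mem_edgeSet] at hK
      by_cases h₃ : ∀ x ∈ s(v, w), σ x = 1
      · by_cases h₁ : s(v, w) ∈ G.edgeSet <;> by_cases h₂ : s(v, w) ∈ H.edgeSet
        · rw [if_neg (by tauto), if_pos ⟨h₁, h₃⟩, if_pos ⟨h₂, h₃⟩]; norm_num
        · rw [if_pos (by tauto), if_pos ⟨h₁, h₃⟩, if_neg (by tauto)]; norm_num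
        · rw [if_pos (by tauto), if_neg (by tauto), if_pos ⟨h₂, h₃⟩]; norm_num
        · rw [if_neg (by tauto), if_neg (by tauto), if_neg (by tauto)]; norm_num
      · rw [if_neg (fun h => h₃ h.2), if_neg (fun h => h₃ h.2), if_neg (fun h => h₃ h.2), mul_one]

/-- Vertices outside the image of `f` meet no edge. This lets an induced subgraph be compared with
graphs on the whole vertex set. -/
theorem edgeSign_map {W : Type} [Fintype W] [DecidableEq W] (f : W ↪ V) (G : SimpleGraph W)
    (σ : V → Fin 2) : edgeSign (G.map f) σ = edgeSign G (fun w => σ (f w)) := by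
  classical
  rw [edgeSign_eq_prod_finset G _ G.edgeFinset (fun e => SimpleGraph.mem_edgeFinset),
    edgeSign_eq_prod_finset (G.map f) σ (G.edgeFinset.map f.sym2Map), Finset.prod_map]
  · refine Finset.prod_congr rfl fun e _ => ?_
    congr 1
    induction e using Sym2.ind with
    | _ v w => simp
  · intro e
    rw [SimpleGraph.edgeSet_map]
    simp

/-- The complete graph on the vertices that satisfy `p`. -/
def cliqueOn (p : V → Prop) : SimpleGraph V where
  Adj v w := v ≠ w ∧ p v ∧ p w
  symm := ⟨fun _ _ h => ⟨h.1.symm, h.2.2, h.2.1⟩⟩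
  loopless := ⟨fun _ h => h.1 rfl⟩

theorem edgeSign_cliqueOn (p : V → Prop) (σ : V → Fin 2) :
    edgeSign (cliqueOn p) σ = (-1) ^ (onesCard p σ).choose 2 := by
  classical
  rw [edgeSign, Finset.prod_ite, Finset.prod_const, Finset.prod_const_one, mul_one, onesCard,
    ← Sym2.card_image_offDiag]
  refine congrArg (fun F : Finset (Sym2 V) => (-1 : ℂ) ^ F.card) ?_
  ext e
  induction e using Sym2.ind with
  | _ v w =>
    rw [Finset.mem_filter]
    simp only [Finset.mem_filter, Finset.mem_univ, true_and, SimpleGraph.mem_edgeSet, cliqueOn,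
      Finset.mem_image, Finset.mem_offDiag, Prod.exists, Function.uncurry_apply_pair, Sym2.mem_iff]
    constructor
    · rintro ⟨⟨h₁, h₂, h₃⟩, h₄⟩
      exact ⟨v, w, ⟨⟨h₂, h₄ v (Or.inl rfl)⟩, ⟨h₃, h₄ w (Or.inr rfl)⟩, h₁⟩, rfl⟩
    · rintro ⟨a, b, ⟨⟨h₁, h₂⟩, ⟨h₃, h₄⟩, h₅⟩, h⟩
      rw [Sym2.eq_iff] at h
      rcases h with ⟨rfl, rfl⟩ | ⟨rfl, rfl⟩
      · exact ⟨⟨h₅, h₁, h₃⟩, by rintro x (rfl | rfl) <;> assumption⟩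
      · exact ⟨⟨h₅.symm, h₃, h₁⟩, by rintro x (rfl | rfl) <;> assumption⟩

/-- The graph that joins `u` to the other vertices that satisfy `p`. -/
def starAt (u : V) (p : V → Prop) : SimpleGraph V where
  Adj v w := v ≠ w ∧ (v = u ∧ p w ∨ w = u ∧ p v)
  symm := ⟨fun _ _ h => ⟨h.1.symm, h.2.symm⟩⟩
  loopless := ⟨fun _ h => h.1 rfl⟩

theorem edgeSign_starAt (u : V) (p : V → Prop) (σ : V → Fin 2) (hu : ¬ p u) :
    edgeSign (starAt u p) σ = if σ u = 1 then (-1) ^ onesCard p σ else 1 := by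
  classical
  rw [edgeSign_eq_prod_finset (starAt u p) σ
    ((Finset.univ.filter p).image fun x => s(u, x)), Finset.prod_image]
  · split_ifs with h
    · rw [← prod_ite_eq_pow_onesCard, Finset.prod_filter]
      refine Finset.prod_congr rfl fun x _ => ?_
      by_cases h₁ : p x <;> simp [h₁, h]
    · refine Finset.prod_eq_one fun x _ => ?_
      simp [h]
  · intro x _ y _ h
    exact Sym2.congr_right.mp h
  · intro e
    induction e using Sym2.ind with
    | _ v w =>
      simp only [Finset.mem_image, Finset.mem_filter, Finset.mem_univ, true_and,
        SimpleGraph.mem_edgeSet, starAt, Sym2.eq_iff]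
      constructor
      · rintro ⟨x, hx, ⟨rfl, rfl⟩ | ⟨rfl, rfl⟩⟩
        · exact ⟨fun h => hu (h ▸ hx), Or.inl ⟨rfl, hx⟩⟩
        · exact ⟨fun h => hu (h ▸ hx), Or.inr ⟨rfl, hx⟩⟩
      · rintro ⟨_, ⟨rfl, h⟩ | ⟨rfl, h⟩⟩
        · exact ⟨w, h, Or.inl ⟨rfl, rfl⟩⟩
        · exact ⟨v, h, Or.inr ⟨rfl, rfl⟩⟩

/-- `G` is the disjoint union, as an edge set, of the graph induced away from `u` and the star at
`u`. -/
theorem edgeSign_delete_vertex (G : SimpleGraph V) (u : V) (σ : V → Fin 2) :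
    edgeSign G σ = edgeSign (G.comap (Subtype.val : {x // x ≠ u} → V)) (fun x => σ x.1) *
      if σ u = 1 then (-1) ^ onesCard (fun x : {x // x ≠ u} => G.Adj u x) (fun x => σ x.1)
      else 1 := by
  rw [onesCard_subtype (fun x => x ≠ u) (fun x => G.Adj u x), ← edgeSign_starAt _ _ _ (by simp)]
  have h := edgeSign_map (Function.Embedding.subtype fun x => x ≠ u)
    (G.comap (Subtype.val : {x // x ≠ u} → V)) σ
  simp only [Function.Embedding.subtype_apply] at h
  rw [← h]
  refine edgeSign_xor _ _ _ (fun v w hvw => ?_) σ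
  simp only [SimpleGraph.map_adj, SimpleGraph.comap_adj, Function.Embedding.subtype_apply,
    Subtype.exists, starAt, xor_def]
  have := G.adj_comm v w
  have hv : (∃ a, ∃ (_ : a ≠ u), ∃ b, ∃ (_ : b ≠ u), G.Adj a b ∧ a = v ∧ b = w) ↔
      v ≠ u ∧ w ≠ u ∧ G.Adj v w := by
    constructor
    · rintro ⟨a, ha, b, hb, h, rfl, rfl⟩
      exact ⟨ha, hb, h⟩
    · rintro ⟨ha, hb, h⟩
      exact ⟨v, ha, w, hb, h, rfl, rfl⟩
  rw [hv]
  grind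

theorem edgeSign_delete_edge (G : SimpleGraph V) (u v : V) (huv : G.Adj u v) (σ : V → Fin 2) :
    edgeSign G σ =
      edgeSign (G.comap (Subtype.val : {x // x ≠ u ∧ x ≠ v} → V)) (fun x => σ x.1) *
      (if σ u = 1 then
        (-1) ^ onesCard (fun x : {x // x ≠ u ∧ x ≠ v} => G.Adj u x) (fun x => σ x.1) else 1) *
      (if σ v = 1 then
        (-1) ^ onesCard (fun x : {x // x ≠ u ∧ x ≠ v} => G.Adj v x) (fun x => σ x.1) else 1) *
      (if σ u = 1 ∧ σ v = 1 then -1 else 1) := by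
  rw [onesCard_subtype (fun x => x ≠ u ∧ x ≠ v) (fun x => G.Adj u x),
    onesCard_subtype (fun x => x ≠ u ∧ x ≠ v) (fun x => G.Adj v x),
    ← edgeSign_starAt _ _ _ (by simp), ← edgeSign_starAt _ _ _ (by simp)]
  -- The edge `uv` is written as a star with the single leaf `v`, so that `G` becomes a symmetric
  -- difference of four graphs.
  have he : (if σ u = 1 ∧ σ v = 1 then -1 else 1 : ℂ) = edgeSign (starAt u fun x => x = v) σ := by
    rw [edgeSign_starAt u _ σ huv.ne]
    by_cases h : σ u = 1
    · rw [if_pos h, ← prod_ite_eq_pow_onesCard, Finset.prod_eq_single v]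
      · simp [h]
      · intro x _ hx
        simp [hx]
      · simp
    · simp [h]
  have h := edgeSign_map (Function.Embedding.subtype fun x => x ≠ u ∧ x ≠ v)
    (G.comap (Subtype.val : {x // x ≠ u ∧ x ≠ v} → V)) σ
  simp only [Function.Embedding.subtype_apply] at h
  rw [← h, he]
  have key : ∀ H₁ H₂ : SimpleGraph V, edgeSign (symmDiff H₁ H₂) σ = edgeSign H₁ σ * edgeSign H₂ σ :=
    fun H₁ H₂ => edgeSign_xor _ _ _ (fun x y _ => by
      simp only [symmDiff, SimpleGraph.sup_adj, SimpleGraph.sdiff_adj, xor_def]) σ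
  rw [← key, ← key, ← key]
  congr 1
  ext x y
  have hv : (∃ a, ∃ (_ : a ≠ u ∧ a ≠ v), ∃ b, ∃ (_ : b ≠ u ∧ b ≠ v), G.Adj a b ∧ a = x ∧ b = y) ↔
      (x ≠ u ∧ x ≠ v) ∧ (y ≠ u ∧ y ≠ v) ∧ G.Adj x y := by
    constructor
    · rintro ⟨a, ha, b, hb, h, rfl, rfl⟩
      exact ⟨ha, hb, h⟩
    · rintro ⟨ha, hb, h⟩
      exact ⟨x, ha, y, hb, h, rfl, rfl⟩
  simp only [symmDiff, SimpleGraph.sup_adj, SimpleGraph.sdiff_adj, SimpleGraph.map_adj,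
    SimpleGraph.comap_adj, Function.Embedding.subtype_apply, Subtype.exists, starAt]
  rw [hv]
  have h₁ := G.adj_comm x y
  have h₂ := huv.ne
  have h₃ := huv.symm
  have h₄ : G.Adj x y → x ≠ y := fun h => h.ne
  by_cases hxu : x = u <;> by_cases hxv : x = v <;> by_cases hyu : y = u <;>
    by_cases hyv : y = v <;> simp_all [eq_comm]

/-- Away from `u`, local complementation is the symmetric difference with the clique on the
neighbours of `u`. -/
theorem edgeSign_localComplement (G : SimpleGraph V) (u : V) (τ : {x // x ≠ u} → Fin 2) :
    edgeSign ((localComplement G u).comap Subtype.val) τ = edgeSign (G.comap Subtype.val) τ *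
      (-1) ^ (onesCard (fun x : {x // x ≠ u} => G.Adj u x) τ).choose 2 := by
  rw [← edgeSign_cliqueOn]
  refine edgeSign_xor _ _ _ (fun x y hxy => ?_) τ
  have : x.1 ≠ y.1 := fun h => hxy (Subtype.ext h)
  simp [localComplement, cliqueOn, hxy, this]

/-- The pivot toggles the pairs taken from two different classes among: neighbours of `u` alone, of
`v` alone, and of both. These pairs form the symmetric difference of the cliques on `N(u)`, `N(v)`
and their symmetric difference, since a pair inside one class lies in exactly two of the three
cliques. -/
theorem edgeSign_pivot (G : SimpleGraph V) (u v : V) (huv : G.Adj u v)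
    (τ : {x // x ≠ u ∧ x ≠ v} → Fin 2) :
    edgeSign ((pivot G u v).comap Subtype.val) τ = edgeSign (G.comap Subtype.val) τ *
      (-1) ^ (onesCard (fun x : {x // x ≠ u ∧ x ≠ v} => G.Adj u x) τ).choose 2 *
      (-1) ^ (onesCard (fun x : {x // x ≠ u ∧ x ≠ v} => G.Adj v x) τ).choose 2 *
      (-1) ^ (onesCard (fun x : {x // x ≠ u ∧ x ≠ v} => Xor (G.Adj u x) (G.Adj v x)) τ).choose 2
      := by
  rw [← edgeSign_cliqueOn, ← edgeSign_cliqueOn, ← edgeSign_cliqueOn]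
  have key : ∀ H₁ H₂ : SimpleGraph {x // x ≠ u ∧ x ≠ v},
      edgeSign (symmDiff H₁ H₂) τ = edgeSign H₁ τ * edgeSign H₂ τ :=
    fun H₁ H₂ => edgeSign_xor _ _ _ (fun x y _ => by
      simp only [symmDiff, SimpleGraph.sup_adj, SimpleGraph.sdiff_adj, xor_def]) τ
  rw [← key, ← key, ← key]
  congr 1
  ext x y
  obtain ⟨x, hxu, hxv⟩ := x
  obtain ⟨y, hyu, hyv⟩ := y
  have h₂ := huv.ne
  have h₃ := huv.symm
  by_cases hxy : x = y
  · subst hxy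
    simp
  simp only [symmDiff, SimpleGraph.sup_adj, SimpleGraph.sdiff_adj, SimpleGraph.comap_adj, pivot,
    localComplement, cliqueOn, xor_def, ne_eq, Subtype.mk.injEq, hxy, not_false_eq_true, true_and,
    G.adj_comm v u, huv, Ne.symm hxu, Ne.symm hxv, Ne.symm hyu, Ne.symm hyv, h₂.symm,
    SimpleGraph.irrefl]
  -- For distinct `x`, `y` outside `{u, v}`, the threefold local complementation depends on these
  -- five adjacencies only.
  by_cases h₁ : G.Adj x y <;> by_cases h₂ : G.Adj u x <;> by_cases h₃ : G.Adj u y <;>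
    by_cases h₄ : G.Adj v x <;> by_cases h₅ : G.Adj v y <;> simp [h₁, h₂, h₃, h₄, h₅]

end EdgeSign

/-! ### Amplitudes of open graphs with angles -/

section PhaseWeight

variable {V : Type} [Fintype V]

/-- The product of the phases of the vertices in state `1`. -/
noncomputable def phaseWeight (α : V → Real.Angle) (σ : V → Fin 2) : ℂ :=
  ∏ v, if σ v = 1 then ((α v).toCircle : ℂ) else 1

theorem phaseWeight_add (α β : V → Real.Angle) (σ : V → Fin 2) :
    phaseWeight (fun v => α v + β v) σ = phaseWeight α σ * phaseWeight β σ := by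
  unfold phaseWeight
  rw [← Finset.prod_mul_distrib]
  refine Finset.prod_congr rfl fun v _ => ?_
  split_ifs <;> simp [Real.Angle.toCircle_add]

theorem phaseWeight_ite (p : V → Prop) [DecidablePred p] (θ : Real.Angle) (σ : V → Fin 2) :
    phaseWeight (fun v => if p v then θ else 0) σ = (θ.toCircle : ℂ) ^ onesCard p σ := by
  rw [← prod_ite_eq_pow_onesCard, phaseWeight]
  refine Finset.prod_congr rfl fun v _ => ?_
  by_cases h₁ : p v <;> by_cases h₂ : σ v = 1 <;> simp [h₁, h₂]

theorem phaseWeight_delete_vertex [DecidableEq V] (α : V → Real.Angle) (u : V) (σ : V → Fin 2) :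
    phaseWeight α σ = (if σ u = 1 then ((α u).toCircle : ℂ) else 1) *
      phaseWeight (fun x : {x // x ≠ u} => α x) (fun x => σ x) := by
  unfold phaseWeight
  rw [Fintype.prod_eq_mul_prod_subtype_ne _ u]

theorem phaseWeight_delete_edge [DecidableEq V] (α : V → Real.Angle) (u v : V) (huv : u ≠ v)
    (σ : V → Fin 2) :
    phaseWeight α σ = (if σ u = 1 then ((α u).toCircle : ℂ) else 1) *
      (if σ v = 1 then ((α v).toCircle : ℂ) else 1) *
      phaseWeight (fun x : {x // x ≠ u ∧ x ≠ v} => α x) (fun x => σ x) := by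
  unfold phaseWeight
  rw [← Fintype.prod_subtype_mul_prod_subtype (fun x => x ≠ u ∧ x ≠ v), mul_comm]
  congr 1
  rw [← Finset.prod_pair (f := fun x => if σ x = 1 then ((α x).toCircle : ℂ) else 1) huv,
    ← Finset.prod_subtype_of_mem (s := {u, v}) (p := fun x => ¬(x ≠ u ∧ x ≠ v))]
  · refine Finset.prod_congr ?_ fun _ _ => rfl
    ext ⟨x, hx⟩
    have : x = u ∨ x = v := by tauto
    simp [this]
  · intro x hx
    simp only [Finset.mem_insert, Finset.mem_singleton] at hx
    tauto

end PhaseWeight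

/-! ### Splitting a sum over states at the deleted vertices. -/

section Sums

variable {V : Type} [Fintype V] [DecidableEq V]

theorem sum_states_delete_vertex (u : V) (F : (V → Fin 2) → ℂ) :
    ∑ σ, F σ = ∑ τ : {x // x ≠ u} → Fin 2, ∑ s : Fin 2,
      F (fun x => if h : x ≠ u then τ ⟨x, h⟩ else s) := by
  rw [← Fintype.sum_prod_type']
  symm
  refine Fintype.sum_equiv
    ((Equiv.prodComm _ _).trans (Equiv.funSplitAt u (Fin 2)).symm) _ _ fun q => ?_
  congr 1
  funext x
  by_cases h : x = u <;> simp [h, Equiv.funSplitAt, Equiv.piSplitAt]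

theorem sum_states_delete_edge (u v : V) (huv : u ≠ v) (F : (V → Fin 2) → ℂ) :
    ∑ σ, F σ = ∑ τ : {x // x ≠ u ∧ x ≠ v} → Fin 2, ∑ s : Fin 2, ∑ t : Fin 2,
      F (fun x => if h : x ≠ u ∧ x ≠ v then τ ⟨x, h⟩ else if x = u then s else t) := by
  simp_rw [← Fintype.sum_prod_type']
  symm
  refine Fintype.sum_equiv
    { toFun := fun q x => if h : x ≠ u ∧ x ≠ v then q.1 ⟨x, h⟩ else if x = u then q.2.1 else q.2.2
      invFun := fun σ => ⟨fun x => σ x, σ u, σ v⟩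
      left_inv := fun q => ?_
      right_inv := fun σ => ?_ } _ _ fun q => rfl
  · refine Prod.ext (funext fun x => ?_) (Prod.ext ?_ ?_)
    · simp [x.2]
    · simp
    · simp [huv.symm]
  · funext x
    by_cases h₁ : x = u <;> by_cases h₂ : x = v <;> simp_all

end Sums

/-- Passing from `a` to `a + 1` multiplies both sides by `-e (-1)^a`; on the left this uses `e² =
-1`, on the right `e⁻¹ = -e` and Pascal's rule. -/
theorem lc_identity {e : ℂ} (he : e ^ 2 = -1) (a : ℕ) :
    1 + e * (-1) ^ a = (1 + e) * (e⁻¹ ^ a * (-1) ^ a.choose 2) := by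
  have he' : e⁻¹ = -e := by
    refine inv_eq_of_mul_eq_one_left ?_
    linear_combination -he
  rw [he']
  induction a with
  | zero => simp
  | succ a ih =>
    have h : (a + 1).choose 2 = a + a.choose 2 := by
      rw [Nat.choose_succ_succ' a 1, Nat.choose_one_right]
    have hs : ((-1 : ℂ) ^ a) * (-1) ^ a = 1 := by
      rw [← mul_pow]; norm_num
    rw [h, pow_add (-1 : ℂ) a (a.choose 2), pow_succ (-e)]
    have : (1 + e) * ((-e) ^ a * -e * ((-1) ^ a * (-1) ^ a.choose 2)) =
        (1 + e) * ((-e) ^ a * (-1) ^ a.choose 2) * (-e * (-1) ^ a) := by ring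
    rw [this, ← ih, pow_succ]
    linear_combination (e ^ 2) * hs + he

theorem neg_one_pow_choose_two_add (x y : ℕ) :
    (-1 : ℂ) ^ (x + y).choose 2 = (-1) ^ x.choose 2 * (-1) ^ y.choose 2 * (-1) ^ (x * y) := by
  rw [← pow_add, ← pow_add]
  congr 1
  induction y with
  | zero => simp
  | succ y ih =>
    rw [← add_assoc, Nat.choose_succ_succ' (x + y) 1, Nat.choose_succ_succ' y 1,
      Nat.choose_one_right, Nat.choose_one_right]
    simp only [Nat.reduceAdd, ih]
    ring

/-- The four terms of a pivot, when the exclusive neighbours of the two vertices and their common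
neighbours contribute `a`, `b` and `c` vertices in state `1`. -/
theorem pivot_identity {e f : ℂ} (he : e = 1 ∨ e = -1) (hf : f = 1 ∨ f = -1) (a b c : ℕ) :
    1 + f * (-1) ^ (b + c) + e * (-1) ^ (a + c) +
        e * f * (-1) ^ (a + c) * (-1) ^ (b + c) * (-1) =
      (1 + f + e - e * f) * (f ^ (a + c) * e ^ (b + c) * (-1) ^ c *
        ((-1) ^ (a + c).choose 2 * (-1) ^ (b + c).choose 2 * (-1) ^ (a + b).choose 2)) := by
  have sq : ∀ k : ℕ, ((-1 : ℂ) ^ k) * (-1) ^ k = 1 := fun k => by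
    rw [← mul_pow]; norm_num
  -- Each of `a`, `b`, `c` occurs in two of the three binomials, so the signs within a class cancel
  -- and only the cross terms remain.
  have h : ((-1 : ℂ) ^ (a + c).choose 2 * (-1) ^ (b + c).choose 2 * (-1) ^ (a + b).choose 2) =
      (-1) ^ (a * c) * (-1) ^ (b * c) * (-1) ^ (a * b) := by
    rw [neg_one_pow_choose_two_add, neg_one_pow_choose_two_add, neg_one_pow_choose_two_add]
    linear_combination ((-1 : ℂ) ^ (a * c) * (-1) ^ (b * c) * (-1) ^ (a * b)) *
      (((-1 : ℂ) ^ b.choose 2 * (-1) ^ b.choose 2 * ((-1) ^ c.choose 2 * (-1) ^ c.choose 2)) *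
        sq (a.choose 2) + ((-1 : ℂ) ^ c.choose 2 * (-1) ^ c.choose 2) * sq (b.choose 2) +
        sq (c.choose 2))
  rw [h]
  -- Only the parities of `a`, `b`, `c` and the signs `e`, `f` matter now, which leaves 32 numerical
  -- cases.
  have par : ∀ k : ℕ, Even k ∨ Odd k := Nat.even_or_odd
  rcases par a with ha | ha <;> rcases par b with hb | hb <;> rcases par c with hc | hc <;>
    rcases he with rfl | rfl <;> rcases hf with rfl | rfl <;>
    simp [pow_add, pow_mul, ha.neg_one_pow, hb.neg_one_pow, hc.neg_one_pow] <;> norm_num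

theorem onesCard_add_onesCard {V : Type} [Fintype V] (p q r : V → Prop)
    (h : ∀ x, r x ↔ p x ∨ q x) (hd : ∀ x, p x → ¬ q x) (σ : V → Fin 2) :
    onesCard r σ = onesCard p σ + onesCard q σ := by
  classical
  unfold onesCard
  rw [← Finset.card_union_of_disjoint]
  · congr 1
    ext x
    simp only [Finset.mem_filter, Finset.mem_univ, true_and, Finset.mem_union, h x]
    tauto
  · refine Finset.disjoint_filter.2 fun x _ h₁ h₂ => hd x h₁.1 h₂.1

/-- `pivot_identity` for the three classes of neighbours: the powers of `f`, `e` and `-1` become the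
phases that the pivot rule adds, and the binomial signs become the change of graph. -/
theorem pivot_sign {V : Type} [Fintype V] [DecidableEq V] (G : SimpleGraph V) (u v : V)
    (huv : G.Adj u v) {e f : ℂ} (he : e = 1 ∨ e = -1) (hf : f = 1 ∨ f = -1) (τ : {x // x ≠ u ∧ x ≠ v} → Fin 2) :
    edgeSign (G.comap Subtype.val) τ *
      (1 + f * (-1) ^ onesCard (fun x : {x // x ≠ u ∧ x ≠ v} => G.Adj v x) τ +
        e * (-1) ^ onesCard (fun x : {x // x ≠ u ∧ x ≠ v} => G.Adj u x) τ +
        e * f * (-1) ^ onesCard (fun x : {x // x ≠ u ∧ x ≠ v} => G.Adj u x) τ *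
          (-1) ^ onesCard (fun x : {x // x ≠ u ∧ x ≠ v} => G.Adj v x) τ * (-1)) =
    (1 + f + e - e * f) * (edgeSign ((pivot G u v).comap Subtype.val) τ *
      (f ^ onesCard (fun x : {x // x ≠ u ∧ x ≠ v} => G.Adj u x) τ *
        e ^ onesCard (fun x : {x // x ≠ u ∧ x ≠ v} => G.Adj v x) τ *
        (-1) ^ onesCard (fun x : {x // x ≠ u ∧ x ≠ v} => G.Adj u x ∧ G.Adj v x) τ)) := by
  have hA := onesCard_add_onesCard
    (fun x : {x // x ≠ u ∧ x ≠ v} => G.Adj u x ∧ ¬ G.Adj v x)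
    (fun x => G.Adj u x ∧ G.Adj v x) (fun x => G.Adj u x)
    (fun x => by tauto) (fun x => by tauto) τ
  have hB := onesCard_add_onesCard
    (fun x : {x // x ≠ u ∧ x ≠ v} => G.Adj v x ∧ ¬ G.Adj u x)
    (fun x => G.Adj u x ∧ G.Adj v x) (fun x => G.Adj v x)
    (fun x => by tauto) (fun x => by tauto) τ
  have hX := onesCard_add_onesCard
    (fun x : {x // x ≠ u ∧ x ≠ v} => G.Adj u x ∧ ¬ G.Adj v x)
    (fun x => G.Adj v x ∧ ¬ G.Adj u x)
    (fun x => Xor (G.Adj u x) (G.Adj v x))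
    (fun x => by rw [xor_def]) (fun x => by tauto) τ
  have key := pivot_identity he hf
    (onesCard (fun x : {x // x ≠ u ∧ x ≠ v} => G.Adj u x ∧ ¬ G.Adj v x) τ)
    (onesCard (fun x : {x // x ≠ u ∧ x ≠ v} => G.Adj v x ∧ ¬ G.Adj u x) τ)
    (onesCard (fun x : {x // x ≠ u ∧ x ≠ v} => G.Adj u x ∧ G.Adj v x) τ)
  rw [← hA, ← hB, ← hX] at key
  rw [edgeSign_pivot _ _ _ huv, key]
  ring

namespace AngledOpenGraph

variable {m n : ℕ}

/-- The amplitude of an open graph with angles, with the inputs and outputs in state `ξ`: the linear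
map of the diagram up to the normalisation of the Hadamard edges. -/
noncomputable def amp (A : AngledOpenGraph m n) (ξ : Fin m ⊕ Fin n → Fin 2) : ℂ :=
  ∑ σ : A.V → Fin 2, phaseWeight A.phase σ *
    (∏ b, if σ (A.terminal b) = ξ b then 1 else 0) * edgeSign A.graph σ

theorem amp_restrict (A : AngledOpenGraph m n) (G : SimpleGraph A.V) (α : A.V → Real.Angle)
    (S : A.V → Prop) [DecidablePred S] (hS : ∀ b, S (A.terminal b))
    (ξ : Fin m ⊕ Fin n → Fin 2) :
    (A.restrict G α S hS).amp ξ = ∑ τ : {x // S x} → Fin 2,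
      phaseWeight (fun x : {x // S x} => α x) τ *
        (∏ b, if τ ⟨A.terminal b, hS b⟩ = ξ b then 1 else 0) *
        edgeSign (G.comap Subtype.val) τ :=
  rfl

theorem amp_delete_vertex (A : AngledOpenGraph m n) (u : A.V) (hu : ∀ b, A.terminal b ≠ u)
    (ξ : Fin m ⊕ Fin n → Fin 2) :
    A.amp ξ = ∑ τ : {x // x ≠ u} → Fin 2,
      phaseWeight (fun x : {x // x ≠ u} => A.phase x) τ *
        (∏ b, if τ ⟨A.terminal b, hu b⟩ = ξ b then 1 else 0) *
        edgeSign (A.graph.comap Subtype.val) τ *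
        (1 + (A.phase u).toCircle *
          (-1) ^ onesCard (fun x : {x // x ≠ u} => A.graph.Adj u x) τ) := by
  rw [amp, sum_states_delete_vertex u]
  refine Finset.sum_congr rfl fun τ _ => ?_
  simp_rw [phaseWeight_delete_vertex A.phase u, edgeSign_delete_vertex A.graph u]
  have h₁ : ∀ s : Fin 2, (fun x : {x // x ≠ u} =>
      (if h : x.1 ≠ u then τ ⟨x.1, h⟩ else s)) = τ := fun s => by
    funext x
    simp [x.2]
  simp only [h₁, Fin.sum_univ_two]
  simp [hu]
  ring

open Classical in
theorem amp_lcSimp (A : AngledOpenGraph m n) (u : A.V) (hu : A.IsInterior u)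
    (he : ((A.phase u).toCircle : ℂ) ^ 2 = -1) (ξ : Fin m ⊕ Fin n → Fin 2) :
    A.amp ξ = (1 + (A.phase u).toCircle) * (A.lcSimp u hu).amp ξ := by
  refine (amp_delete_vertex A u hu ξ).trans (Eq.trans ?_ (congrArg _
    (amp_restrict A _ _ (fun x => x ≠ u) hu ξ).symm))
  rw [Finset.mul_sum]
  refine Finset.sum_congr rfl fun τ _ => ?_
  rw [lc_identity he, edgeSign_localComplement]
  have h : (fun x : {x // x ≠ u} => A.phase x - if A.graph.Adj u x then A.phase u else 0) =
      fun x : {x // x ≠ u} => A.phase x + if A.graph.Adj u x then -A.phase u else 0 := by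
    funext x
    split_ifs <;> simp [sub_eq_add_neg]
  rw [h, phaseWeight_add,
    phaseWeight_ite (fun x : {x // x ≠ u} => A.graph.Adj u x), Real.Angle.toCircle_neg,
    Circle.coe_inv]
  ring

theorem amp_deleteVertex (A : AngledOpenGraph m n) (u : A.V) (hu : A.IsInterior u)
    (hisol : ∀ v, ¬ A.graph.Adj u v) (ξ : Fin m ⊕ Fin n → Fin 2) :
    A.amp ξ = (1 + (A.phase u).toCircle) * (A.deleteVertex u hu).amp ξ := by
  refine (amp_delete_vertex A u hu ξ).trans (Eq.trans ?_ (congrArg _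
    (amp_restrict A _ _ (fun x => x ≠ u) hu ξ).symm))
  rw [Finset.mul_sum]
  refine Finset.sum_congr rfl fun τ _ => ?_
  have : onesCard (fun x : {x // x ≠ u} => A.graph.Adj u x) τ = 0 := by
    simp [onesCard, hisol]
  rw [this]
  ring

theorem amp_delete_edge (A : AngledOpenGraph m n) (u v : A.V)
    (h : ∀ b, A.terminal b ≠ u ∧ A.terminal b ≠ v) (huv : A.graph.Adj u v)
    (ξ : Fin m ⊕ Fin n → Fin 2) :
    A.amp ξ = ∑ τ : {x // x ≠ u ∧ x ≠ v} → Fin 2,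
      phaseWeight (fun x : {x // x ≠ u ∧ x ≠ v} => A.phase x) τ *
        (∏ b, if τ ⟨A.terminal b, h b⟩ = ξ b then 1 else 0) *
        edgeSign (A.graph.comap Subtype.val) τ *
        (1 + (A.phase v).toCircle *
            (-1) ^ onesCard (fun x : {x // x ≠ u ∧ x ≠ v} => A.graph.Adj v x) τ +
          (A.phase u).toCircle *
            (-1) ^ onesCard (fun x : {x // x ≠ u ∧ x ≠ v} => A.graph.Adj u x) τ +
          (A.phase u).toCircle * (A.phase v).toCircle *
            (-1) ^ onesCard (fun x : {x // x ≠ u ∧ x ≠ v} => A.graph.Adj u x) τ *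
            (-1) ^ onesCard (fun x : {x // x ≠ u ∧ x ≠ v} => A.graph.Adj v x) τ * (-1)) := by
  rw [amp, sum_states_delete_edge u v huv.ne]
  refine Finset.sum_congr rfl fun τ _ => ?_
  simp_rw [phaseWeight_delete_edge A.phase u v huv.ne, edgeSign_delete_edge A.graph u v huv]
  have h₁ : ∀ s t : Fin 2, (fun x : {x // x ≠ u ∧ x ≠ v} =>
      (if h : x.1 ≠ u ∧ x.1 ≠ v then τ ⟨x.1, h⟩ else if x.1 = u then s else t)) = τ :=
    fun s t => by
      funext x
      simp [x.2]
  simp only [h₁, Fin.sum_univ_two]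
  simp [h, huv.ne.symm]
  ring

open Classical in
theorem amp_pivotSimp (A : AngledOpenGraph m n) (u v : A.V) (hu : A.IsInterior u)
    (hv : A.IsInterior v) (huv : A.graph.Adj u v)
    (hpu : A.phase u = 0 ∨ A.phase u = (Real.pi : Real.Angle))
    (hpv : A.phase v = 0 ∨ A.phase v = (Real.pi : Real.Angle)) :
    ∃ c : ℂ, c ≠ 0 ∧ ∀ ξ, A.amp ξ = c * (A.pivotSimp u v hu hv).amp ξ := by
  have pauli : ∀ θ : Real.Angle, θ = 0 ∨ θ = (Real.pi : Real.Angle) →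
      ((θ.toCircle : ℂ) = 1 ∨ (θ.toCircle : ℂ) = -1) := by
    rintro θ (rfl | rfl) <;> simp
  have he := pauli _ hpu
  have hf := pauli _ hpv
  refine ⟨1 + (A.phase v).toCircle + (A.phase u).toCircle -
    (A.phase u).toCircle * (A.phase v).toCircle, ?_, fun ξ => ?_⟩
  -- The scalar is `-2` when both phases are `π`, and `2` otherwise.
  · rcases he with he | he <;> rcases hf with hf | hf <;> rw [he, hf] <;> norm_num
  refine (amp_delete_edge A u v (fun b => ⟨hu b, hv b⟩) huv ξ).trans (Eq.trans ?_ (congrArg _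
    (amp_restrict A _ _ (fun x => x ≠ u ∧ x ≠ v) (fun b => ⟨hu b, hv b⟩) ξ).symm))
  rw [Finset.mul_sum]
  refine Finset.sum_congr rfl fun τ _ => ?_
  rw [mul_assoc, pivot_sign A.graph u v huv he hf, phaseWeight_add, phaseWeight_add,
    phaseWeight_add, phaseWeight_ite (fun x : {x // x ≠ u ∧ x ≠ v} => A.graph.Adj u x),
    phaseWeight_ite (fun x : {x // x ≠ u ∧ x ≠ v} => A.graph.Adj v x),
    phaseWeight_ite (fun x : {x // x ≠ u ∧ x ≠ v} => A.graph.Adj u x ∧ A.graph.Adj v x),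
    Real.Angle.toCircle_coe, Circle.coe_exp, Complex.exp_pi_mul_I]
  ring

end AngledOpenGraph

/-! ### Graph-like diagrams are open graphs with angles -/

namespace AngledOpenGraph

variable {m n : ℕ} (A : AngledOpenGraph m n)

theorem toZX_plain_spider (v w : A.V) : A.toZX.plain s(Sum.inl v, Sum.inl w) = 0 := by
  simp [toZX]

theorem toZX_plain_terminal (v : A.V) (b : Fin m ⊕ Fin n) :
    A.toZX.plain s(Sum.inl v, Sum.inr b) ≠ 0 ↔ A.terminal b = v := by
  simp [toZX, eq_comm]

theorem toZX_had_terminal (v : A.V) (b : Fin m ⊕ Fin n) :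
    A.toZX.had s(Sum.inl v, Sum.inr b) = 0 := by
  simp [toZX]

theorem toZX_had_spider (v w : A.V) :
    A.toZX.had s(Sum.inl v, Sum.inl w) ≠ 0 ↔ A.graph.Adj v w := by
  simp only [toZX, Sym2.eq_iff, Sum.inl.injEq, ne_eq, ite_eq_right_iff, one_ne_zero, imp_false,
    not_not]
  constructor
  · rintro ⟨a, b, h, ⟨rfl, rfl⟩ | ⟨rfl, rfl⟩⟩
    exacts [h, h.symm]
  · intro h
    exact ⟨v, w, h, Or.inl ⟨rfl, rfl⟩⟩

theorem toZX_connected_spider (v w : A.V) :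
    A.toZX.Connected (Sum.inl v) (Sum.inl w) ↔ A.graph.Adj v w := by
  rw [ZXDiagram.Connected, ← toZX_had_spider]
  exact ⟨fun h => h.resolve_left fun h => h (A.toZX_plain_spider v w), Or.inr⟩

theorem toZX_connected_terminal (v : A.V) (b : Fin m ⊕ Fin n) :
    A.toZX.Connected (Sum.inl v) (Sum.inr b) ↔ A.terminal b = v := by
  rw [ZXDiagram.Connected, ← toZX_plain_terminal]
  exact ⟨fun h => h.resolve_right fun h => h (A.toZX_had_terminal v b), Or.inl⟩

theorem toZX_isBoundary (v : A.V) : A.toZX.IsBoundary v ↔ ∃ b, A.terminal b = v :=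
  exists_congr fun b => A.toZX_connected_terminal v b

theorem toZX_isInterior (v : A.V) : A.toZX.IsInterior v ↔ A.IsInterior v := by
  change ¬ A.toZX.IsBoundary v ↔ _
  rw [toZX_isBoundary, not_exists]
  rfl

theorem toZX_isGraphLike : A.toZX.IsGraphLike where
  all_Z _ := rfl
  no_plain := A.toZX_plain_spider
  no_parallel v w := by
    simp only [toZX]
    split_ifs <;> simp
  no_loop v := by
    by_contra h
    exact A.graph.irrefl ((A.toZX_had_spider v v).1 h)
  boundary_spider b := ⟨A.terminal b, (A.toZX_plain_terminal _ b).2 rfl⟩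
  at_most_one v b b' h h' := A.terminal.injective
    (((A.toZX_connected_terminal v b).1 h).trans ((A.toZX_connected_terminal v b').1 h').symm)

end AngledOpenGraph

/-- One plain wire already exhausts the total degree `1` at `b`. -/
theorem ZXDiagram.wires_at_boundary {m n : ℕ} (D : ZXDiagram m n) (b : Fin m ⊕ Fin n)
    (a : D.Node) (h : D.plain s(a, Sum.inr b) ≠ 0) :
    D.plain s(a, Sum.inr b) = 1 ∧ D.had s(a, Sum.inr b) = 0 ∧
      ∀ c, c ≠ a → D.plain s(c, Sum.inr b) = 0 ∧ D.had s(c, Sum.inr b) = 0 := by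
  have hdeg := D.boundary_degree b
  rw [← Finset.add_sum_erase _ _ (Finset.mem_univ a)] at hdeg
  rw [Sym2.eq_swap] at h
  have h₀ : ∑ c ∈ Finset.univ.erase a, (D.plain s(Sum.inr b, c) + D.had s(Sum.inr b, c)) = 0 := by
    omega
  rw [Finset.sum_eq_zero_iff] at h₀
  refine ⟨?_, ?_, fun c hc => ?_⟩
  · rw [Sym2.eq_swap]; omega
  · rw [Sym2.eq_swap]; omega
  · have := h₀ c (Finset.mem_erase.2 ⟨hc, Finset.mem_univ c⟩)
    rw [Sym2.eq_swap]
    omega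

/-- The spider type is kept literally, so equality of diagrams reduces to equality of functions,
without casts. -/
theorem ZXDiagram.eq_mk {m n : ℕ} (D : ZXDiagram m n) (colour plain had hdeg)
    (hc : D.colour = colour) (hp : D.plain = plain) (hh : D.had = had) :
    D = { Spider := D.Spider, colour := colour, phase := D.phase, plain := plain, had := had,
          boundary_degree := hdeg } := by
  subst hc hp hh
  rfl

/-- `Step` matches only diagrams of the form `toZX`; without this representation, the absence of a
step would say nothing about a graph-like diagram. -/
theorem ZXDiagram.IsGraphLike.exists_eq_toZX {m n : ℕ} {D : ZXDiagram m n} (hD : D.IsGraphLike) :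
    ∃ A : AngledOpenGraph m n, D = A.toZX := by
  choose t ht using hD.boundary_spider
  have hw := fun b => D.wires_at_boundary b (Sum.inl (t b)) (ht b)
  refine ⟨{ V := D.Spider
            graph :=
              { Adj := fun v w => D.had s(Sum.inl v, Sum.inl w) ≠ 0
                symm := ⟨fun v w h => by rwa [Sym2.eq_swap]⟩
                loopless := ⟨fun v h => h (hD.no_loop v)⟩ }
            phase := D.phase
            terminal := ⟨t, fun b b' h =>
              hD.at_most_one (t b) b b' (Or.inl (ht b)) (Or.inl (h ▸ ht b'))⟩ },
    D.eq_mk _ _ _ _ (funext hD.all_Z) (funext fun p => ?_) (funext fun p => ?_)⟩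
  · split_ifs with h
    · obtain ⟨b, rfl⟩ := h
      exact (hw b).1
    · induction p using Sym2.ind with
      | _ a c =>
        rcases a with v | b
        · rcases c with w | b
          · exact hD.no_plain v w
          · refine ((hw b).2.2 (Sum.inl v) fun hv => h ⟨b, by rw [hv]; rfl⟩).1
        · rw [Sym2.eq_swap]
          refine ((hw b).2.2 c fun hv => h ⟨b, by rw [hv, Sym2.eq_swap]; rfl⟩).1
  · have key : ∀ c b, D.had s(c, Sum.inr b) = 0 := fun c b => by
      by_cases hc : c = Sum.inl (t b)
      · rw [hc, (hw b).2.1]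
      · exact ((hw b).2.2 c hc).2
    split_ifs with h
    · obtain ⟨v, w, h, rfl⟩ := h
      exact le_antisymm (hD.no_parallel v w) (Nat.one_le_iff_ne_zero.2 h)
    · induction p using Sym2.ind with
      | _ a c =>
        rcases a with v | b
        · rcases c with w | b
          · by_contra h'
            exact h ⟨v, w, h', rfl⟩
          · exact key _ b
        · rw [Sym2.eq_swap]
          exact key _ b

/-! ### The linear map of an open graph with angles -/

theorem wireValue_one_ket {N : Type} (f : N → Fin 2 → ℂ) (a c : N) (s t : Fin 2)
    (ha : f a = Colour.Z.ket s) (hc : f c = Colour.Z.ket t) :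
    wireValue 1 Matrix.isSymm_one f s(a, c) = if s = t then 1 else 0 := by
  change f a ⬝ᵥ (1 *ᵥ f c) = _
  rw [ha, hc, Matrix.one_mulVec]
  fin_cases s <;> fin_cases t <;> simp [Colour.ket, dotProduct]

theorem wireValue_hadamard_ket {N : Type} (f : N → Fin 2 → ℂ) (a c : N) (s t : Fin 2)
    (ha : f a = Colour.Z.ket s) (hc : f c = Colour.Z.ket t) :
    wireValue hadamard hadamard_isSymm f s(a, c) =
      ((Real.sqrt 2 : ℝ) : ℂ)⁻¹ * if s = 1 ∧ t = 1 then -1 else 1 := by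
  change f a ⬝ᵥ (hadamard *ᵥ f c) = _
  rw [ha, hc]
  fin_cases s <;> fin_cases t <;> simp [Colour.ket, dotProduct, hadamard, Matrix.mulVec]

theorem prod_pow_ite {ι κ : Type} [Fintype ι] (P : ι → Prop) [DecidablePred P] (F : Finset κ)
    (g : κ → ι) (hg : Function.Injective g) (hP : ∀ p, P p ↔ ∃ k ∈ F, g k = p) (f : ι → ℂ) :
    ∏ p, f p ^ (if P p then 1 else 0) = ∏ k ∈ F, f (g k) := by
  have h : F.map ⟨g, hg⟩ = Finset.univ.filter P := by
    ext p
    simp [hP]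
  refine Eq.trans ?_ (Finset.prod_map F ⟨g, hg⟩ f)
  rw [h, Finset.prod_filter]
  refine Finset.prod_congr rfl fun p _ => ?_
  split_ifs <;> simp

open Classical in
theorem AngledOpenGraph.interp_toZX {m n : ℕ} (A : AngledOpenGraph m n) :
    ∃ c : ℂ, c ≠ 0 ∧ ∀ x y, A.toZX.interp y x = c * A.amp (Sum.elim x y) := by
  have h2 : (((Real.sqrt 2 : ℝ) : ℂ)⁻¹) ≠ 0 := by simp
  -- Each Hadamard edge carries the normalisation of `H`; the plain wires contribute only the
  -- pinning of the boundary spiders.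
  refine ⟨(((Real.sqrt 2 : ℝ) : ℂ)⁻¹) ^ A.graph.edgeFinset.card, pow_ne_zero _ h2, fun x y => ?_⟩
  rw [AngledOpenGraph.amp, Finset.mul_sum]
  change ∑ σ : A.V → Fin 2, _ = _
  refine Finset.sum_congr rfl fun σ _ => ?_
  rw [Finset.prod_mul_distrib]
  have hb : ∀ b, A.toZX.legState σ x y (Sum.inr b) = Colour.Z.ket (Sum.elim x y b) := by
    rintro (b | b) <;> rfl
  have h₁ : ∏ p : Sym2 A.toZX.Node,
      wireValue 1 Matrix.isSymm_one (A.toZX.legState σ x y) p ^ A.toZX.plain p =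
      ∏ b, if σ (A.terminal b) = Sum.elim x y b then 1 else 0 := by
    refine (prod_pow_ite (ι := Sym2 (A.V ⊕ (Fin m ⊕ Fin n))) _ Finset.univ
      (fun b => s(Sum.inl (A.terminal b), Sum.inr b)) (fun b b' h => ?_) (fun p => ?_) _).trans ?_
    · simpa using h
    · simp only [Finset.mem_univ, true_and, eq_comm]
    · exact Finset.prod_congr rfl fun b _ => wireValue_one_ket _ _ _ _ _ rfl (hb b)
  have h₂ : ∏ p : Sym2 A.toZX.Node,
      wireValue hadamard hadamard_isSymm (A.toZX.legState σ x y) p ^ A.toZX.had p =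
      (((Real.sqrt 2 : ℝ) : ℂ)⁻¹) ^ A.graph.edgeFinset.card * edgeSign A.graph σ := by
    refine (prod_pow_ite (ι := Sym2 (A.V ⊕ (Fin m ⊕ Fin n))) _ A.graph.edgeFinset
      (Sym2.map Sum.inl) (Sym2.map.injective Sum.inl_injective) (fun p => ?_) _).trans ?_
    · constructor
      · rintro ⟨v, w, h, rfl⟩
        exact ⟨s(v, w), SimpleGraph.mem_edgeFinset.2 h, rfl⟩
      · rintro ⟨e, he, rfl⟩
        induction e using Sym2.ind with
        | _ v w => exact ⟨v, w, SimpleGraph.mem_edgeFinset.1 he, rfl⟩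
    · rw [edgeSign_eq_prod_finset A.graph σ A.graph.edgeFinset
        (fun e => SimpleGraph.mem_edgeFinset), ← Finset.prod_const, ← Finset.prod_mul_distrib]
      refine Finset.prod_congr rfl fun e _ => ?_
      induction e using Sym2.ind with
      | _ v w =>
        refine (wireValue_hadamard_ket _ _ _ (σ v) (σ w) rfl rfl).trans ?_
        simp
  rw [h₁, h₂]
  change phaseWeight A.phase σ * _ = _
  ring

/-! ### Angles -/

theorem IsPauliAngle.eq_zero_or_pi {α : Real.Angle} (h : IsPauliAngle α) :
    α = 0 ∨ α = (Real.pi : Real.Angle) := by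
  obtain ⟨k, rfl⟩ := h
  rcases Int.even_or_odd' k with ⟨l, rfl | rfl⟩
  · left
    refine (Real.Angle.angle_eq_iff_two_pi_dvd_sub (ψ := 0)).2 ⟨l, ?_⟩
    push_cast
    ring
  · right
    refine Real.Angle.angle_eq_iff_two_pi_dvd_sub.2 ⟨l, ?_⟩
    push_cast
    ring

theorem IsPauliAngle.isCliffordAngle {α : Real.Angle} (h : IsPauliAngle α) :
    IsCliffordAngle α := by
  obtain ⟨k, rfl⟩ := h
  refine ⟨2 * k, ?_⟩
  congr 1
  push_cast
  ring

theorem IsCliffordAngle.isPauliAngle {α : Real.Angle} (h : IsCliffordAngle α)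
    (h' : ¬ IsProperCliffordAngle α) : IsPauliAngle α := by
  obtain ⟨k, rfl⟩ := h
  rcases Int.even_or_odd' k with ⟨l, rfl | rfl⟩
  · refine ⟨l, ?_⟩
    congr 1
    push_cast
    ring
  · refine absurd ⟨l, ?_⟩ h'
    congr 1
    push_cast
    ring

theorem isCliffordAngle_zero : IsCliffordAngle 0 := ⟨0, by simp⟩

theorem isCliffordAngle_pi : IsCliffordAngle (Real.pi : Real.Angle) :=
  IsPauliAngle.isCliffordAngle ⟨1, by simp⟩

theorem IsCliffordAngle.add {α β : Real.Angle} (hα : IsCliffordAngle α) (hβ : IsCliffordAngle β) :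
    IsCliffordAngle (α + β) := by
  obtain ⟨k, rfl⟩ := hα
  obtain ⟨l, rfl⟩ := hβ
  refine ⟨k + l, ?_⟩
  rw [← Real.Angle.coe_add]
  congr 1
  push_cast
  ring

theorem IsCliffordAngle.sub {α β : Real.Angle} (hα : IsCliffordAngle α) (hβ : IsCliffordAngle β) :
    IsCliffordAngle (α - β) := by
  obtain ⟨k, rfl⟩ := hα
  obtain ⟨l, rfl⟩ := hβ
  refine ⟨k - l, ?_⟩
  rw [← Real.Angle.coe_sub]
  congr 1
  push_cast
  ring

theorem IsCliffordAngle.ite {α β : Real.Angle} (p : Prop) {_ : Decidable p} (hα : IsCliffordAngle α)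
    (hβ : IsCliffordAngle β) : IsCliffordAngle (if p then α else β) := by
  split_ifs <;> assumption

theorem IsProperCliffordAngle.toCircle_sq {α : Real.Angle} (h : IsProperCliffordAngle α) :
    (α.toCircle : ℂ) ^ 2 = -1 := by
  obtain ⟨k, rfl⟩ := h
  rw [Real.Angle.toCircle_coe, Circle.coe_exp, ← Complex.exp_nat_mul, ← Complex.exp_pi_mul_I,
    Complex.exp_eq_exp_iff_exists_int]
  -- Twice the angle differs from `π` by `k` full turns.
  refine ⟨k, ?_⟩
  push_cast
  ring

theorem IsProperCliffordAngle.one_add_toCircle_ne_zero {α : Real.Angle}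
    (h : IsProperCliffordAngle α) : (1 : ℂ) + α.toCircle ≠ 0 := by
  intro h₀
  have h₁ := h.toCircle_sq
  rw [eq_neg_of_add_eq_zero_right h₀] at h₁
  norm_num at h₁

/-! ### Single-qubit gates -/

theorem phaseGate_zero : phaseGate 0 = 1 := by
  ext i j
  fin_cases i <;> fin_cases j <;> simp [phaseGate]

theorem phaseGate_add (α β : Real.Angle) : phaseGate (α + β) = phaseGate α * phaseGate β := by
  ext i j
  fin_cases i <;> fin_cases j <;> simp [phaseGate, Matrix.mul_apply, Real.Angle.toCircle_add]

theorem phaseGate_nsmul (k : ℕ) (α : Real.Angle) : phaseGate (k • α) = phaseGate α ^ k := by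
  induction k with
  | zero => simp [phaseGate_zero]
  | succ k ih => rw [succ_nsmul, phaseGate_add, ih, pow_succ]

theorem IsCliffordAngle.isLocalClifford_phaseGate {α : Real.Angle} (h : IsCliffordAngle α) :
    IsLocalClifford (phaseGate α) := by
  obtain ⟨k, rfl⟩ := h
  -- Reduction modulo `4` removes `k / 4` full turns and turns a possibly negative multiple into a
  -- natural power of `S`.
  have hk : ((k * (Real.pi / 2) : ℝ) : Real.Angle) =
      (k % 4).toNat • ((Real.pi / 2 : ℝ) : Real.Angle) := by
    rw [← Real.Angle.coe_nsmul]
    refine Real.Angle.angle_eq_iff_two_pi_dvd_sub.2 ⟨k / 4, ?_⟩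
    have h₁ : ((k % 4).toNat : ℤ) = k % 4 := Int.toNat_of_nonneg (Int.emod_nonneg _ (by norm_num))
    have h₂ : k = 4 * (k / 4) + k % 4 := (Int.mul_ediv_add_emod k 4).symm
    have h₃ : (k : ℝ) = 4 * ((k / 4 : ℤ) : ℝ) + ((k % 4).toNat : ℝ) := by
      have : (k : ℝ) = ((4 * (k / 4) + ((k % 4).toNat : ℤ) : ℤ) : ℝ) := by
        rw [h₁, ← h₂]
      rw [this]
      push_cast
      ring
    rw [nsmul_eq_mul, h₃]
    ring
  rw [hk, phaseGate_nsmul]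
  exact Submonoid.pow_mem _ (Submonoid.subset_closure (by simp)) _

theorem isLocalClifford_hadamard : IsLocalClifford hadamard :=
  Submonoid.subset_closure (by simp)

theorem inv_sqrt_two_mul_self :
    ((Real.sqrt 2 : ℝ) : ℂ)⁻¹ * ((Real.sqrt 2 : ℝ) : ℂ)⁻¹ = 1 / 2 := by
  rw [← mul_inv, ← Complex.ofReal_mul, Real.mul_self_sqrt (by norm_num)]
  norm_num

theorem hadamard_mem_unitaryGroup : hadamard ∈ Matrix.unitaryGroup (Fin 2) ℂ := by
  rw [Matrix.mem_unitaryGroup_iff]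
  have h := inv_sqrt_two_mul_self
  ext i j
  fin_cases i <;> fin_cases j <;>
    simp [hadamard, Matrix.mul_apply, Matrix.star_apply] at h ⊢ <;>
    linear_combination 2 * h

theorem phaseGate_mem_unitaryGroup (α : Real.Angle) :
    phaseGate α ∈ Matrix.unitaryGroup (Fin 2) ℂ := by
  rw [Matrix.mem_unitaryGroup_iff]
  ext i j
  fin_cases i <;> fin_cases j <;>
    simp [phaseGate, Matrix.mul_apply, Matrix.star_apply, Complex.mul_conj]

/-- The input gate and the output gate are transposes of each other. Their common entry is, up to
`1/√2`, the kernel in `amp_unfuse`, which thus serves inputs and outputs alike. -/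
theorem hadamard_mul_phaseGate_apply (α : Real.Angle) (s t : Fin 2) :
    (hadamard * phaseGate α) s t = ((Real.sqrt 2 : ℝ) : ℂ)⁻¹ *
      ((if s = 1 ∧ t = 1 then -1 else 1) * if t = 1 then (α.toCircle : ℂ) else 1) := by
  fin_cases s <;> fin_cases t <;> simp [hadamard, phaseGate, Matrix.mul_apply]

theorem phaseGate_mul_hadamard_apply (α : Real.Angle) (s t : Fin 2) :
    (phaseGate α * hadamard) t s = ((Real.sqrt 2 : ℝ) : ℂ)⁻¹ *
      ((if s = 1 ∧ t = 1 then -1 else 1) * if t = 1 then (α.toCircle : ℂ) else 1) := by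
  fin_cases s <;> fin_cases t <;> simp [hadamard, phaseGate, Matrix.mul_apply] <;> ring

theorem tensorGates_mul {k : ℕ} (U W : Fin k → Matrix (Fin 2) (Fin 2) ℂ) :
    tensorGates (fun i => U i * W i) = tensorGates U * tensorGates W := by
  ext y x
  simp only [tensorGates, Matrix.of_apply, Matrix.mul_apply, Fintype.prod_sum,
    Finset.prod_mul_distrib]

theorem tensorGates_update_apply {k : ℕ} (i : Fin k) (G : Matrix (Fin 2) (Fin 2) ℂ)
    (y x : Fin k → Fin 2) :
    tensorGates (Function.update 1 i G) y x =
      G (y i) (x i) * if ∀ l, l ≠ i → y l = x l then 1 else 0 := by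
  rw [tensorGates, Matrix.of_apply, Fintype.prod_eq_mul_prod_subtype_ne _ i, Function.update_self]
  congr 1
  have h : ∀ l : {l // l ≠ i}, (Function.update (1 : Fin k → Matrix (Fin 2) (Fin 2) ℂ) i G l.1)
      (y l) (x l) = if y l = x l then 1 else 0 := fun l => by
    rw [Function.update_of_ne l.2, Pi.one_apply, Matrix.one_apply]
  simp only [h, Finset.prod_ite_zero, Finset.prod_const_one, Finset.mem_univ, true_imp_iff,
    Subtype.forall]

/-- Only the intermediate states that agree with `x` away from `i` survive. -/
theorem mul_tensorGates_update_apply {k : ℕ} {ι : Type} (M : Matrix ι (Fin k → Fin 2) ℂ)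
    (i : Fin k) (G : Matrix (Fin 2) (Fin 2) ℂ) (y : ι) (x : Fin k → Fin 2) :
    (M * tensorGates (Function.update 1 i G)) y x =
      ∑ s, M y (Function.update x i s) * G s (x i) := by
  rw [Matrix.mul_apply]
  symm
  refine Fintype.sum_of_injective (fun s => Function.update x i s)
    (Function.update_injective x i) _ _ (fun x' hx' => ?_) (fun s => ?_)
  · rw [tensorGates_update_apply, if_neg, mul_zero, mul_zero]
    intro h
    refine hx' ⟨x' i, ?_⟩
    funext l
    by_cases hl : l = i
    · subst hl
      simp
    · simp [hl, h l hl]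
  · rw [tensorGates_update_apply, if_pos, mul_one, Function.update_self]
    intro l hl
    rw [Function.update_of_ne hl]

theorem tensorGates_update_mul_apply {k : ℕ} {ι : Type} (M : Matrix (Fin k → Fin 2) ι ℂ)
    (i : Fin k) (G : Matrix (Fin 2) (Fin 2) ℂ) (y : Fin k → Fin 2) (x : ι) :
    (tensorGates (Function.update 1 i G) * M) y x =
      ∑ s, M (Function.update y i s) x * G (y i) s := by
  rw [Matrix.mul_apply]
  symm
  refine Fintype.sum_of_injective (fun s => Function.update y i s)
    (Function.update_injective y i) _ _ (fun x' hx' => ?_) (fun s => ?_)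
  · rw [tensorGates_update_apply, if_neg, mul_zero, zero_mul]
    intro h
    refine hx' ⟨x' i, ?_⟩
    funext l
    by_cases hl : l = i
    · subst hl
      simp
    · simp [hl, h l hl]
  · rw [tensorGates_update_apply, if_pos, mul_one, Function.update_self, mul_comm]
    intro l hl
    rw [Function.update_of_ne hl]

/-! ### Unfusing a boundary spider -/

theorem sum_states_option {V : Type} [Fintype V] [DecidableEq V] (F : (Option V → Fin 2) → ℂ) :
    ∑ σ, F σ = ∑ t : Fin 2, ∑ σ : V → Fin 2, F (fun x => x.elim t σ) := by
  rw [← Fintype.sum_prod_type']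
  symm
  refine Fintype.sum_equiv (Equiv.piOptionEquivProd (β := fun _ => Fin 2)).symm _ _ fun q => ?_
  congr 1
  funext x
  cases x <;> rfl

namespace AngledOpenGraph

variable {m n : ℕ}

/-- Unfusing adds one pendant edge to the graph. -/
theorem edgeSign_unfuse (A : AngledOpenGraph m n) (b : Fin m ⊕ Fin n) (t : Fin 2)
    (σ : A.V → Fin 2) :
    edgeSign (V := Option A.V) (A.unfuse b).graph (fun x => x.elim t σ) = edgeSign A.graph σ *
      if t = 1 ∧ σ (A.terminal b) = 1 then -1 else 1 := by
  classical
  refine (edgeSign_xor (V := Option A.V) (A.graph.map Function.Embedding.some)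
    (starAt none fun x => x = some (A.terminal b)) _ (fun v w hvw => ?_) _).trans ?_
  · have h := SimpleGraph.map_adj Function.Embedding.some A.graph v w
    rw [xor_def, h]
    rcases v with _ | v <;> rcases w with _ | w <;> simp [unfuse, starAt]
  · rw [edgeSign_map, edgeSign_starAt _ _ _ (by simp)]
    congr 1
    by_cases ht : t = 1
    · rw [← prod_ite_eq_pow_onesCard, Finset.prod_eq_single (some (A.terminal b))]
      · simp [ht]
      · intro x _ hx
        simp [hx]
      · simp
    · simp [ht]

theorem phaseWeight_unfuse (A : AngledOpenGraph m n) (b : Fin m ⊕ Fin n) (t : Fin 2)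
    (σ : A.V → Fin 2) :
    phaseWeight (V := Option A.V) (A.unfuse b).phase (fun x => x.elim t σ) =
      phaseWeight (fun v => if v = A.terminal b then 0 else A.phase v) σ := by
  refine (Fintype.prod_option _).trans ?_
  have h : (if t = 1 then ((0 : Real.Angle).toCircle : ℂ) else 1) = 1 := by simp
  exact (congrArg (· * _) h).trans (one_mul _)

theorem phaseWeight_eq_mul (A : AngledOpenGraph m n) (b : Fin m ⊕ Fin n) (σ : A.V → Fin 2) :
    phaseWeight A.phase σ = phaseWeight (fun v => if v = A.terminal b then 0 else A.phase v) σ *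
      if σ (A.terminal b) = 1 then ((A.phase (A.terminal b)).toCircle : ℂ) else 1 := by
  unfold phaseWeight
  rw [Fintype.prod_eq_mul_prod_subtype_ne _ (A.terminal b),
    Fintype.prod_eq_mul_prod_subtype_ne (fun v => if σ v = 1 then
      (((if v = A.terminal b then 0 else A.phase v : Real.Angle)).toCircle : ℂ) else 1)
      (A.terminal b), mul_comm]
  congr 1
  simp only [if_true, Real.Angle.toCircle_zero, Circle.coe_one, ite_self, one_mul]
  refine Finset.prod_congr rfl fun v _ => ?_
  rw [if_neg v.2]

theorem prod_terminal_unfuse (A : AngledOpenGraph m n) (b : Fin m ⊕ Fin n) (s t : Fin 2)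
    (σ : A.V → Fin 2) (ξ : Fin m ⊕ Fin n → Fin 2) :
    (∏ b', if ((A.unfuse b).terminal b' : Option A.V).elim t σ = Function.update ξ b s b' then 1
      else 0 : ℂ) =
    (if t = s then 1 else 0) *
      ∏ b' : {b' // b' ≠ b}, if σ (A.terminal b') = ξ b' then 1 else 0 := by
  rw [Fintype.prod_eq_mul_prod_subtype_ne _ b]
  congr 1
  · have h : (A.unfuse b).terminal b = (none : Option A.V) := if_pos rfl
    rw [h, Function.update_self]
    rfl
  · refine Finset.prod_congr rfl fun b' _ => ?_
    have h : (A.unfuse b).terminal b' = (some (A.terminal b') : Option A.V) := if_neg b'.2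
    rw [Function.update_of_ne b'.2, h]
    rfl

/-- This is `H H = 1` without the normalisation, and the source of the factor `2` in `amp_unfuse`.
-/
theorem sum_sign (s t : Fin 2) :
    ∑ r : Fin 2, (if r = 1 ∧ s = 1 then -1 else 1 : ℂ) * (if r = 1 ∧ t = 1 then -1 else 1) =
      if s = t then 2 else 0 := by
  fin_cases s <;> fin_cases t <;> norm_num [Fin.sum_univ_two]

/-- Two Hadamards are inserted between the boundary spider and `b`: one becomes the edge to the new
spider, the other joins the phase in the split-off gate. -/
theorem amp_unfuse (A : AngledOpenGraph m n) (b : Fin m ⊕ Fin n) (ξ : Fin m ⊕ Fin n → Fin 2) :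
    2 * A.amp ξ = ∑ s : Fin 2, (A.unfuse b).amp (Function.update ξ b s) *
      ((if s = 1 ∧ ξ b = 1 then -1 else 1) *
        if ξ b = 1 then ((A.phase (A.terminal b)).toCircle : ℂ) else 1) := by
  have h : ∀ s : Fin 2, (A.unfuse b).amp (Function.update ξ b s) = ∑ σ : A.V → Fin 2,
      phaseWeight (fun v => if v = A.terminal b then 0 else A.phase v) σ *
        (∏ b' : {b' // b' ≠ b}, if σ (A.terminal b') = ξ b' then 1 else 0) *
        (edgeSign A.graph σ * if s = 1 ∧ σ (A.terminal b) = 1 then -1 else 1) := by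
    intro s
    refine (sum_states_option (V := A.V) _).trans ?_
    -- The terminal pins the new spider to `s`, so a single branch survives.
    rw [Finset.sum_eq_single s]
    · refine Finset.sum_congr rfl fun σ _ => ?_
      have h₁ := A.prod_terminal_unfuse b s s σ ξ
      rw [if_pos rfl, one_mul] at h₁
      rw [← h₁, ← edgeSign_unfuse, ← phaseWeight_unfuse A b s]
      rfl
    · intro t _ ht
      refine Finset.sum_eq_zero fun σ _ => ?_
      have h₁ := A.prod_terminal_unfuse b s t σ ξ
      rw [if_neg ht, zero_mul] at h₁
      exact mul_eq_zero_of_left (mul_eq_zero_of_right _ h₁) _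
    · simp
  simp_rw [h, Finset.sum_mul]
  rw [Finset.sum_comm, amp, Finset.mul_sum]
  refine Finset.sum_congr rfl fun σ _ => ?_
  rw [phaseWeight_eq_mul A b σ, Fintype.prod_eq_mul_prod_subtype_ne _ b]
  -- Summation over `s` restores the constraint that the old boundary spider carries the bit `ξ b`.
  have hs := sum_sign (σ (A.terminal b)) (ξ b)
  rw [Fin.sum_univ_two] at hs ⊢
  by_cases hb : σ (A.terminal b) = ξ b
  · rw [if_pos hb] at hs ⊢
    rw [hb] at hs ⊢
    linear_combination (-(phaseWeight (fun v => if v = A.terminal b then 0 else A.phase v) σ *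
        (∏ b' : {b' // b' ≠ b}, if σ (A.terminal b') = ξ b' then 1 else 0) *
        edgeSign A.graph σ *
          if ξ b = 1 then ((A.phase (A.terminal b)).toCircle : ℂ) else 1)) * hs
  · rw [if_neg hb] at hs ⊢
    linear_combination (-(phaseWeight (fun v => if v = A.terminal b then 0 else A.phase v) σ *
        (∏ b' : {b' // b' ≠ b}, if σ (A.terminal b') = ξ b' then 1 else 0) *
        edgeSign A.graph σ *
          if ξ b = 1 then ((A.phase (A.terminal b)).toCircle : ℂ) else 1)) * hs

end AngledOpenGraph

/-! ### Soundness of the rewrite rules -/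

variable {m n : ℕ}

theorem AngledOpenGraph.exists_interp_eq_smul {A B : AngledOpenGraph m n} {c : ℂ} (hc : c ≠ 0)
    (h : ∀ ξ, A.amp ξ = c * B.amp ξ) : ∃ z : ℂ, z ≠ 0 ∧ A.toZX.interp = z • B.toZX.interp := by
  obtain ⟨a, ha, hA⟩ := A.interp_toZX
  obtain ⟨b, hb, hB⟩ := B.interp_toZX
  refine ⟨a * c * b⁻¹, mul_ne_zero (mul_ne_zero ha hc) (inv_ne_zero hb), ?_⟩
  ext y x
  rw [Matrix.smul_apply, hA, hB, h, smul_eq_mul]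
  field_simp

/-- Bookkeeping of scalars: `a` and `b` are the edge normalisations of the two diagrams, `c` is the
scalar of the boundary pivot, and `r = √2` comes from the split-off Hadamard. -/
theorem mul_rescale {a b c r X k : ℂ} (hb : b ≠ 0) (hr : r ≠ 0) :
    a * (c * (X * k)) = a * c * b⁻¹ * r * (b * X * (r⁻¹ * k)) := by
  field_simp

/-- Once unfused, the boundary spider is interior with phase `0`, so the Pauli pivot applies
whatever its original phase was. -/
theorem AngledOpenGraph.amp_boundaryPivotSimp (A : AngledOpenGraph m n) (b : Fin m ⊕ Fin n)
    (u : A.V) (hu : A.IsInterior u) (hpu : IsPauliAngle (A.phase u))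
    (hadj : A.graph.Adj u (A.terminal b)) :
    ∃ c : ℂ, c ≠ 0 ∧ ∀ ξ, A.amp ξ = c * ∑ s : Fin 2,
      (A.boundaryPivotSimp b u hu).amp (Function.update ξ b s) *
      ((if s = 1 ∧ ξ b = 1 then -1 else 1) *
        if ξ b = 1 then ((A.phase (A.terminal b)).toCircle : ℂ) else 1) := by
  have h₁ : (A.unfuse b).phase (some u) = A.phase u := if_neg hadj.ne
  have h₂ : (A.unfuse b).phase (some (A.terminal b)) = 0 := if_pos rfl
  obtain ⟨c, hc, h⟩ := (A.unfuse b).amp_pivotSimp (some u) (some (A.terminal b))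
    (A.unfuse_interior b u hu) (A.unfuse_interior_boundary b) hadj
    (by rw [h₁]; exact hpu.eq_zero_or_pi) (Or.inl h₂)
  refine ⟨c / 2, div_ne_zero hc (by norm_num), fun ξ => ?_⟩
  have h₃ := A.amp_unfuse b ξ
  simp_rw [h, mul_assoc] at h₃
  rw [← Finset.mul_sum] at h₃
  change _ = c / 2 * ∑ s : Fin 2,
      ((A.unfuse b).pivotSimp (some u) (some (A.terminal b)) (A.unfuse_interior b u hu)
        (A.unfuse_interior_boundary b)).amp (Function.update ξ b s) * _
  linear_combination h₃ / 2

theorem AngledOpenGraph.interp_inputPivot (A : AngledOpenGraph m n) (i : Fin m)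
    (u : A.V) (hu : A.IsInterior u) (hpu : IsPauliAngle (A.phase u))
    (hadj : A.graph.Adj u (A.terminal (Sum.inl i))) :
    ∃ z : ℂ, z ≠ 0 ∧ A.toZX.interp = z • ((A.boundaryPivotSimp (Sum.inl i) u hu).toZX.interp *
      tensorGates (Function.update 1 i
        (hadamard * phaseGate (A.phase (A.terminal (Sum.inl i)))))) := by
  obtain ⟨c, hc, h⟩ := A.amp_boundaryPivotSimp (Sum.inl i) u hu hpu hadj
  obtain ⟨a, ha, hA⟩ := A.interp_toZX
  obtain ⟨b, hb, hB⟩ := (A.boundaryPivotSimp (Sum.inl i) u hu).interp_toZX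
  have h2 : ((Real.sqrt 2 : ℝ) : ℂ) ≠ 0 := by simp
  refine ⟨a * c * b⁻¹ * ((Real.sqrt 2 : ℝ) : ℂ),
    mul_ne_zero (mul_ne_zero (mul_ne_zero ha hc) (inv_ne_zero hb)) h2, ?_⟩
  ext y x
  rw [Matrix.smul_apply, hA, h, smul_eq_mul, mul_tensorGates_update_apply, Finset.mul_sum,
    Finset.mul_sum, Finset.mul_sum]
  refine Finset.sum_congr rfl fun s _ => ?_
  rw [hB, hadamard_mul_phaseGate_apply, Sum.elim_update_left, Sum.elim_inl]
  exact mul_rescale hb h2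

theorem AngledOpenGraph.interp_outputPivot (A : AngledOpenGraph m n) (j : Fin n)
    (u : A.V) (hu : A.IsInterior u) (hpu : IsPauliAngle (A.phase u))
    (hadj : A.graph.Adj u (A.terminal (Sum.inr j))) :
    ∃ z : ℂ, z ≠ 0 ∧ A.toZX.interp = z • (tensorGates (Function.update 1 j
        (phaseGate (A.phase (A.terminal (Sum.inr j))) * hadamard)) *
      (A.boundaryPivotSimp (Sum.inr j) u hu).toZX.interp) := by
  obtain ⟨c, hc, h⟩ := A.amp_boundaryPivotSimp (Sum.inr j) u hu hpu hadj
  obtain ⟨a, ha, hA⟩ := A.interp_toZX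
  obtain ⟨b, hb, hB⟩ := (A.boundaryPivotSimp (Sum.inr j) u hu).interp_toZX
  have h2 : ((Real.sqrt 2 : ℝ) : ℂ) ≠ 0 := by simp
  refine ⟨a * c * b⁻¹ * ((Real.sqrt 2 : ℝ) : ℂ),
    mul_ne_zero (mul_ne_zero (mul_ne_zero ha hc) (inv_ne_zero hb)) h2, ?_⟩
  ext y x
  rw [Matrix.smul_apply, hA, h, smul_eq_mul, tensorGates_update_mul_apply, Finset.mul_sum,
    Finset.mul_sum, Finset.mul_sum]
  refine Finset.sum_congr rfl fun s _ => ?_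
  rw [hB, phaseGate_mul_hadamard_apply, Sum.elim_update_right, Sum.elim_inr]
  exact mul_rescale hb h2

/-- Written as a pointwise product, the update lets `tensorGates_mul` place the new gate next to the
diagram. -/
theorem update_mul_left {k : ℕ} (P : Fin k → Matrix (Fin 2) (Fin 2) ℂ) (i : Fin k)
    (G : Matrix (Fin 2) (Fin 2) ℂ) :
    Function.update P i (G * P i) =
      fun l => Function.update (1 : Fin k → Matrix (Fin 2) (Fin 2) ℂ) i G l * P l := by
  funext l
  by_cases h : l = i
  · subst h
    simp
  · simp [h]

theorem update_mul_right {k : ℕ} (Q : Fin k → Matrix (Fin 2) (Fin 2) ℂ) (j : Fin k)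
    (G : Matrix (Fin 2) (Fin 2) ℂ) :
    Function.update Q j (Q j * G) =
      fun l => Q l * Function.update (1 : Fin k → Matrix (Fin 2) (Fin 2) ℂ) j G l := by
  funext l
  by_cases h : l = j
  · subst h
    simp
  · simp [h]

theorem Config.exists_interp_eq_smul {D E : ZXDiagram m n}
    (P : Fin m → Matrix (Fin 2) (Fin 2) ℂ) (Q : Fin n → Matrix (Fin 2) (Fin 2) ℂ)
    (h : ∃ z : ℂ, z ≠ 0 ∧ D.interp = z • E.interp) :
    ∃ z : ℂ, z ≠ 0 ∧
      (Config.mk D P Q).interp = z • (Config.mk E P Q).interp := by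
  obtain ⟨z, hz, h⟩ := h
  refine ⟨z, hz, ?_⟩
  simp only [Config.interp, h, Matrix.mul_smul, Matrix.smul_mul]

theorem Step.interp_eq {C C' : Config m n} (h : Step C C') :
    ∃ z : ℂ, z ≠ 0 ∧ C.interp = z • C'.interp := by
  cases h with
  | lc A P Q u hu hphase =>
    exact Config.exists_interp_eq_smul P Q (AngledOpenGraph.exists_interp_eq_smul
      hphase.one_add_toCircle_ne_zero (A.amp_lcSimp u hu hphase.toCircle_sq))
  | pivot A P Q u v hu hv huv hpu hpv =>
    obtain ⟨c, hc, h⟩ := A.amp_pivotSimp u v hu hv huv hpu.eq_zero_or_pi hpv.eq_zero_or_pi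
    exact Config.exists_interp_eq_smul P Q (AngledOpenGraph.exists_interp_eq_smul hc h)
  | inputPivot A P Q u hu hpu i hadj =>
    obtain ⟨z, hz, h⟩ := A.interp_inputPivot i u hu hpu hadj
    refine ⟨z, hz, ?_⟩
    simp only [Config.interp]
    rw [update_mul_left, tensorGates_mul, h]
    simp only [Matrix.mul_smul, Matrix.smul_mul, Matrix.mul_assoc]
  | outputPivot A P Q u hu hpu j hadj =>
    obtain ⟨z, hz, h⟩ := A.interp_outputPivot j u hu hpu hadj
    refine ⟨z, hz, ?_⟩
    simp only [Config.interp, h, update_mul_right, tensorGates_mul, Matrix.mul_smul,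
      Matrix.smul_mul, Matrix.mul_assoc]
  | scalar A P Q u hu hisol hphase =>
    refine Config.exists_interp_eq_smul P Q (AngledOpenGraph.exists_interp_eq_smul
      ?_ (A.amp_deleteVertex u hu hisol))
    rw [hphase]
    norm_num

theorem Step.isGraphLike {C C' : Config m n} (h : Step C C') : C'.diagram.IsGraphLike := by
  cases h <;> exact AngledOpenGraph.toZX_isGraphLike _

/-! ### Counting spiders. -/

theorem AngledOpenGraph.card_pivotSimp (A : AngledOpenGraph m n) (u v : A.V) (hu : A.IsInterior u)
    (hv : A.IsInterior v) (huv : u ≠ v) :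
    Nat.card (A.pivotSimp u v hu hv).V + 2 = Nat.card A.V := by
  change Nat.card {x // x ≠ u ∧ x ≠ v} + 2 = _
  rw [Nat.card_eq_fintype_card, Nat.card_eq_fintype_card, Fintype.card_subtype,
    ← Finset.card_univ, ← Finset.card_pair huv,
    ← Finset.card_sdiff_add_card_inter Finset.univ {u, v}]
  congr 2
  · ext x
    simp
  · simp

/-- Unfusing adds one spider and the pivot removes two, so the net loss is one. -/
theorem AngledOpenGraph.card_boundaryPivotSimp (A : AngledOpenGraph m n) (b : Fin m ⊕ Fin n)
    (u : A.V) (hu : A.IsInterior u) :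
    Nat.card (A.boundaryPivotSimp b u hu).V + 1 = Nat.card A.V := by
  have h := (A.unfuse b).card_pivotSimp (some u) (some (A.terminal b)) (A.unfuse_interior b u hu)
    (A.unfuse_interior_boundary b) (fun h => hu b (Option.some.inj h).symm)
  have h' : Nat.card (A.unfuse b).V = Nat.card A.V + 1 := Finite.card_option
  change Nat.card ((A.unfuse b).pivotSimp _ _ _ _).V + 1 = _
  omega

theorem card_delete_lt {V : Type} [Finite V] (u : V) : Nat.card {x // x ≠ u} < Nat.card V :=
  Finite.card_subtype_lt (x := u) (by simp)

theorem Step.card_lt {C C' : Config m n} (h : Step C C') :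
    Nat.card C'.diagram.Spider < Nat.card C.diagram.Spider := by
  cases h with
  | lc A P Q u hu => exact card_delete_lt u
  | pivot A P Q u v hu hv huv =>
    have := A.card_pivotSimp u v hu hv huv.ne
    change Nat.card (A.pivotSimp u v hu hv).V < Nat.card A.V
    omega
  | inputPivot A P Q u hu hpu i =>
    have := A.card_boundaryPivotSimp (Sum.inl i) u hu
    change Nat.card (A.boundaryPivotSimp (Sum.inl i) u hu).V < Nat.card A.V
    omega
  | outputPivot A P Q u hu hpu j =>
    have := A.card_boundaryPivotSimp (Sum.inr j) u hu
    change Nat.card (A.boundaryPivotSimp (Sum.inr j) u hu).V < Nat.card A.V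
    omega
  | scalar A P Q u => exact card_delete_lt u

/-! ### Preservation of the class of gates and of Clifford phases. -/

theorem forall_update_mem {k : ℕ} (S : Set (Matrix (Fin 2) (Fin 2) ℂ))
    (P : Fin k → Matrix (Fin 2) (Fin 2) ℂ) (hP : ∀ i, P i ∈ S) (i : Fin k)
    (G : Matrix (Fin 2) (Fin 2) ℂ) (hG : G ∈ S) : ∀ l, Function.update P i G l ∈ S := by
  intro l
  by_cases h : l = i
  · subst h
    simpa using hG
  · simpa [h] using hP l

/-- The submonoid is left arbitrary, so that one argument covers both the unitary group and the
local Cliffords. -/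
theorem Step.gates_mem {C C' : Config m n} (h : Step C C')
    (S : Submonoid (Matrix (Fin 2) (Fin 2) ℂ)) (hH : hadamard ∈ S)
    (hS : ∀ v, phaseGate (C.diagram.phase v) ∈ S)
    (hin : ∀ i, C.inGate i ∈ S) (hout : ∀ j, C.outGate j ∈ S) :
    (∀ i, C'.inGate i ∈ S) ∧ ∀ j, C'.outGate j ∈ S := by
  cases h with
  | lc => exact ⟨hin, hout⟩
  | pivot => exact ⟨hin, hout⟩
  | inputPivot A P Q u hu hpu i hadj =>
    exact ⟨forall_update_mem S P hin i _ (S.mul_mem (S.mul_mem hH (hS _)) (hin i)), hout⟩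
  | outputPivot A P Q u hu hpu j hadj =>
    exact ⟨hin, forall_update_mem S Q hout j _ (S.mul_mem (hout j) (S.mul_mem (hS _) hH))⟩
  | scalar => exact ⟨hin, hout⟩

theorem AngledOpenGraph.isCliffordAngle_pivotSimp (A : AngledOpenGraph m n) (u v : A.V)
    (hu : A.IsInterior u) (hv : A.IsInterior v) (h : ∀ x, IsCliffordAngle (A.phase x))
    (x : (A.pivotSimp u v hu hv).V) : IsCliffordAngle ((A.pivotSimp u v hu hv).phase x) :=
  (((h _).add ((h v).ite _ isCliffordAngle_zero)).add ((h u).ite _ isCliffordAngle_zero)).add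
    (isCliffordAngle_pi.ite _ isCliffordAngle_zero)

theorem AngledOpenGraph.isCliffordAngle_unfuse (A : AngledOpenGraph m n) (b : Fin m ⊕ Fin n)
    (h : ∀ x, IsCliffordAngle (A.phase x)) (x : (A.unfuse b).V) :
    IsCliffordAngle ((A.unfuse b).phase x) := by
  rcases x with _ | x
  · exact isCliffordAngle_zero
  · exact isCliffordAngle_zero.ite _ (h x)

theorem Step.isCliffordAngle {C C' : Config m n} (h : Step C C')
    (hC : ∀ v, IsCliffordAngle (C.diagram.phase v)) (v : C'.diagram.Spider) :
    IsCliffordAngle (C'.diagram.phase v) := by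
  cases h with
  | lc A P Q u hu => exact (hC _).sub ((hC u).ite _ isCliffordAngle_zero)
  | pivot A P Q u w hu hv => exact A.isCliffordAngle_pivotSimp u w hu hv hC _
  | inputPivot A P Q u hu hpu i =>
    exact (A.unfuse _).isCliffordAngle_pivotSimp _ _ (A.unfuse_interior _ u hu)
      (A.unfuse_interior_boundary _) (A.isCliffordAngle_unfuse _ hC) _
  | outputPivot A P Q u hu hpu j =>
    exact (A.unfuse _).isCliffordAngle_pivotSimp _ _ (A.unfuse_interior _ u hu)
      (A.unfuse_interior_boundary _) (A.isCliffordAngle_unfuse _ hC) _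
  | scalar A P Q u hu => exact hC _

/-! ### Termination and invariants of reachable configurations. -/

theorem not_exists_infinite_steps :
    ¬ ∃ c : ℕ → Config m n, ∀ k, Step (c k) (c (k + 1)) := by
  rintro ⟨c, hc⟩
  -- After `k` steps at least `k` spiders are gone, which fails for `k` one larger than the initial
  -- number.
  have h : ∀ k, Nat.card (c k).diagram.Spider + k ≤ Nat.card (c 0).diagram.Spider := by
    intro k
    induction k with
    | zero => simp
    | succ k ih =>
      have := (hc k).card_lt
      omega
  have := h (Nat.card (c 0).diagram.Spider + 1)
  omega

theorem exists_reaches_isFinal (C : Config m n) : ∃ C', Reaches C C' ∧ IsFinal C' := by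
  induction hk : Nat.card C.diagram.Spider using Nat.strong_induction_on generalizing C with
  | _ k ih =>
    by_cases hC : IsFinal C
    · exact ⟨C, Relation.ReflTransGen.refl, hC⟩
    · simp only [IsFinal, not_forall, not_not] at hC
      obtain ⟨C₁, h₁⟩ := hC
      obtain ⟨C₂, h₂, hf⟩ := ih _ (hk ▸ h₁.card_lt) C₁ rfl
      exact ⟨C₂, Relation.ReflTransGen.head h₁ h₂, hf⟩

theorem tensorGates_one {k : ℕ} :
    tensorGates (fun _ : Fin k => (1 : Matrix (Fin 2) (Fin 2) ℂ)) = 1 := by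
  ext y x
  simp only [tensorGates, Matrix.of_apply, Matrix.one_apply, Finset.prod_ite_zero,
    Finset.prod_const_one, Finset.mem_univ, true_imp_iff, funext_iff]

theorem Config.interp_init (D : ZXDiagram m n) : (Config.init D).interp = D.interp := by
  simp only [Config.interp, Config.init, tensorGates_one, Matrix.one_mul, Matrix.mul_one]

theorem Reaches.invariant {D : ZXDiagram m n} (hD : D.IsGraphLike) {C : Config m n}
    (h : Reaches (Config.init D) C) :
    C.diagram.IsGraphLike ∧ (∀ i, C.inGate i ∈ Matrix.unitaryGroup (Fin 2) ℂ) ∧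
      (∀ j, C.outGate j ∈ Matrix.unitaryGroup (Fin 2) ℂ) ∧
      ∃ z : ℂ, z ≠ 0 ∧ D.interp = z • C.interp := by
  induction h with
  | refl =>
    exact ⟨hD, fun _ => Submonoid.one_mem _, fun _ => Submonoid.one_mem _, 1, one_ne_zero, by
      rw [one_smul, Config.interp_init]⟩
  | tail _ hs ih =>
    obtain ⟨_, hin, hout, z, hz, h⟩ := ih
    obtain ⟨w, hw, h'⟩ := hs.interp_eq
    have hg := hs.gates_mem _ hadamard_mem_unitaryGroup
      (fun v => phaseGate_mem_unitaryGroup _) hin hout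
    exact ⟨hs.isGraphLike, hg.1, hg.2, z * w, mul_ne_zero hz hw, by rw [h, h', smul_smul]⟩

theorem Reaches.clifford_invariant {D : ZXDiagram m n}
    (hD : ∀ v, IsCliffordAngle (D.phase v)) {C : Config m n} (h : Reaches (Config.init D) C) :
    (∀ v, IsCliffordAngle (C.diagram.phase v)) ∧ (∀ i, IsLocalClifford (C.inGate i)) ∧
      ∀ j, IsLocalClifford (C.outGate j) := by
  induction h with
  | refl => exact ⟨hD, fun _ => Submonoid.one_mem _, fun _ => Submonoid.one_mem _⟩
  | tail _ hs ih =>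
    obtain ⟨hC, hin, hout⟩ := ih
    exact ⟨hs.isCliffordAngle hC, hs.gates_mem _ isLocalClifford_hadamard
      (fun v => (hC v).isLocalClifford_phaseGate) hin hout⟩

/-- The isolated spider factors out as `1 + e^(iπ) = 0`. -/
theorem AngledOpenGraph.interp_eq_zero (A : AngledOpenGraph m n) (u : A.V) (hu : A.IsInterior u)
    (hisol : ∀ v, ¬ A.graph.Adj u v) (hphase : A.phase u = (Real.pi : Real.Angle)) :
    A.toZX.interp = 0 := by
  obtain ⟨c, -, hc⟩ := A.interp_toZX
  ext y x
  rw [hc, A.amp_deleteVertex u hu hisol, hphase, Real.Angle.toCircle_coe, Circle.coe_exp,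
    Complex.exp_pi_mul_I]
  simp

/-! ### Configurations to which no rule applies -/

section Final

variable {A : AngledOpenGraph m n} {P : Fin m → Matrix (Fin 2) (Fin 2) ℂ}
  {Q : Fin n → Matrix (Fin 2) (Fin 2) ℂ}

theorem IsFinal.not_isProperCliffordAngle (h : IsFinal ⟨A.toZX, P, Q⟩) {u : A.V}
    (hu : A.IsInterior u) : ¬ IsProperCliffordAngle (A.phase u) :=
  fun hp => h _ (Step.lc A P Q u hu hp)

theorem IsFinal.not_adj_pauli (h : IsFinal ⟨A.toZX, P, Q⟩) {u v : A.V} (huv : A.graph.Adj u v)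
    (hu : A.IsInterior u) (hpu : IsPauliAngle (A.phase u)) (hv : A.IsInterior v) :
    ¬ IsPauliAngle (A.phase v) :=
  fun hpv => h _ (Step.pivot A P Q u v hu hv huv hpu hpv)

theorem IsFinal.not_adj_terminal (h : IsFinal ⟨A.toZX, P, Q⟩) {u : A.V}
    (hu : A.IsInterior u) (hpu : IsPauliAngle (A.phase u)) (b : Fin m ⊕ Fin n) :
    ¬ A.graph.Adj u (A.terminal b) := by
  intro hadj
  rcases b with i | j
  · exact h _ (Step.inputPivot A P Q u hu hpu i hadj)
  · exact h _ (Step.outputPivot A P Q u hu hpu j hadj)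

/-- All interior spiders are Pauli here, so an interior neighbour would permit a pivot and a
boundary neighbour a boundary pivot; once isolated, phase `0` would permit deletion. -/
theorem IsFinal.clifford_interior (h : IsFinal ⟨A.toZX, P, Q⟩)
    (hA : ∀ v, IsCliffordAngle (A.phase v)) {u : A.V} (hu : A.IsInterior u) :
    A.phase u = (Real.pi : Real.Angle) ∧ ∀ v, ¬ A.graph.Adj u v := by
  have hpu := (hA u).isPauliAngle (h.not_isProperCliffordAngle hu)
  have hisol : ∀ v, ¬ A.graph.Adj u v := by
    intro v huv
    by_cases hv : A.IsInterior v
    · exact h.not_adj_pauli huv hu hpu hv ((hA v).isPauliAngle (h.not_isProperCliffordAngle hv))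
    · simp only [AngledOpenGraph.IsInterior, not_forall, not_not] at hv
      obtain ⟨b, rfl⟩ := hv
      exact h.not_adj_terminal hu hpu b huv
  exact ⟨hpu.eq_zero_or_pi.resolve_left fun h₀ => h _ (Step.scalar A P Q u hu hisol h₀), hisol⟩

end Final

end ZX

/-! ### Assembly of the theorem. -/

theorem mainTheorem2 {m n : ℕ} (D : ZX.ZXDiagram m n) (hD : D.IsGraphLike) :
    -- the procedure terminates, whatever the order in which the rules are applied
    (¬ ∃ c : ℕ → ZX.Config m n, c 0 = ZX.Config.init D ∧ ∀ k, ZX.Step (c k) (c (k + 1))) ∧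
    (∃ C, ZX.Reaches (ZX.Config.init D) C ∧ ZX.IsFinal C) ∧
    -- at every stage, the diagram is graph-like and equal to `D` up to single-qubit unitaries
    (∀ C, ZX.Reaches (ZX.Config.init D) C →
      C.diagram.IsGraphLike ∧
      (∀ i, C.inGate i ∈ Matrix.unitaryGroup (Fin 2) ℂ) ∧
      (∀ j, C.outGate j ∈ Matrix.unitaryGroup (Fin 2) ℂ) ∧
      ∃ z : ℂ, z ≠ 0 ∧ D.interp = z • C.interp) ∧
    -- the resulting diagrams
    (∀ C, ZX.Reaches (ZX.Config.init D) C → ZX.IsFinal C →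
      (¬ ∃ v, C.diagram.IsInterior v ∧ ZX.IsProperCliffordAngle (C.diagram.phase v)) ∧
      (¬ ∃ v w, C.diagram.Connected (Sum.inl v) (Sum.inl w) ∧
        C.diagram.IsInterior v ∧ ZX.IsPauliAngle (C.diagram.phase v) ∧
        C.diagram.IsInterior w ∧ ZX.IsPauliAngle (C.diagram.phase w)) ∧
      (¬ ∃ v w, C.diagram.Connected (Sum.inl v) (Sum.inl w) ∧
        C.diagram.IsInterior v ∧ ZX.IsPauliAngle (C.diagram.phase v) ∧
        C.diagram.IsBoundary w) ∧
      -- the Clifford case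
      ((∀ v, ZX.IsCliffordAngle (D.phase v)) →
        (∀ v, ZX.IsCliffordAngle (C.diagram.phase v)) ∧
        (∀ i, ZX.IsLocalClifford (C.inGate i)) ∧
        (∀ j, ZX.IsLocalClifford (C.outGate j)) ∧
        (∀ v, C.diagram.IsInterior v → C.diagram.phase v = (Real.pi : Real.Angle) ∧
          ∀ w, ¬ C.diagram.Connected (Sum.inl v) (Sum.inl w)) ∧
        (D.interp ≠ 0 → ∀ v, ¬ C.diagram.IsInterior v))) := by
  refine ⟨fun ⟨c, _, hc⟩ => ZX.not_exists_infinite_steps ⟨c, hc⟩, ZX.exists_reaches_isFinal _,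
    fun C hC => hC.invariant hD, fun C hC hF => ?_⟩
  obtain ⟨hgl, -, -, z, hz, hDC⟩ := hC.invariant hD
  have hcl := fun h => hC.clifford_invariant (D := D) h
  obtain ⟨E, P, Q⟩ := C
  -- The final diagram is replaced by an open graph, on which the unmatched rules can be read off.
  obtain ⟨A, rfl⟩ : ∃ A : ZX.AngledOpenGraph m n, E = A.toZX := hgl.exists_eq_toZX
  refine ⟨?_, ?_, ?_, fun hclD => ⟨(hcl hclD).1, (hcl hclD).2.1, (hcl hclD).2.2, ?_, ?_⟩⟩
  · rintro ⟨v, hv, hp⟩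
    exact hF.not_isProperCliffordAngle ((A.toZX_isInterior v).1 hv) hp
  · rintro ⟨v, w, hvw, hv, hpv, hw, hpw⟩
    exact hF.not_adj_pauli ((A.toZX_connected_spider v w).1 hvw) ((A.toZX_isInterior v).1 hv) hpv
      ((A.toZX_isInterior w).1 hw) hpw
  · rintro ⟨v, w, hvw, hv, hpv, hw⟩
    obtain ⟨b, rfl⟩ := (A.toZX_isBoundary w).1 hw
    exact hF.not_adj_terminal ((A.toZX_isInterior v).1 hv) hpv b
      ((A.toZX_connected_spider v _).1 hvw)
  · intro v hv
    obtain ⟨h₁, h₂⟩ := hF.clifford_interior (hcl hclD).1 ((A.toZX_isInterior v).1 hv)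
    exact ⟨h₁, fun w hw => h₂ w ((A.toZX_connected_spider v w).1 hw)⟩
  · intro hne v hv
    have hv' := (A.toZX_isInterior v).1 hv
    obtain ⟨h₁, h₂⟩ := hF.clifford_interior (hcl hclD).1 hv'
    refine hne ?_
    rw [hDC, ZX.Config.interp]
    change z • (_ * A.toZX.interp * _) = 0
    rw [A.interp_eq_zero v hv' h₂ h₁, Matrix.mul_zero, Matrix.zero_mul, smul_zero]
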